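/- Let $M$ be a complex manifold of dimension $n$ and $p\in M$. For a tuple $\alpha=(\alpha_1,\dots,\alpha_m)$, $m\ge 1$, of germs at $p$ of holomorphic functions with $\alpha_j(p)=0$, and for an integer $0\le \ell\le m$, put $$\langle\alpha,\alpha\rangle_\ell=\sum_{j=1}^{\ell}|\alpha_j|^2-\sum_{k=\ell+1}^{m}|\alpha_k|^2 .$$ Let $\tilde\Lambda_p$ be the algebra of all germs $a+\langle\alpha,\alpha\rangle_\ell$ at $p$ with $a\in\mathbb R$ and $\alpha,\ell$ as above, let $\tilde K_p$ be its field of fractions, and let $\mathbb R_p$ be the set of germs at $p$ of real constants. A real function defined near $p$ is of diastasis type if it is real analytic near $p$ and its expansion $\sum a_{jk}z^j\bar z^k$ in some complex coordinates $z$ centered at $p$ has $a_{j0}=a_{0j}=0$ for all multi-indices $j\neq 0$. For $\mu\in\mathbb R$ let $$\tilde\Lambda_p^{\mu}\tilde K_p=\{f^\mu h \mid f\in\tilde\Lambda_p,\ h\in\tilde K_p\},$$ where the real power $f^\mu$ is taken on the open set $\{f>0\}$, which is required to have $p$ in its closure, and where a germ $w$ at $p$ is said to be equal to $f^\mu h$,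 $h=N/D$ with $N,D\in\tilde\Lambda_p$, $D\neq 0$, if $w=f^\mu N/D$ at all points near $p$ at which $f>0$ and $D\ne 0$. Theorem. Let $\mu$ be a real number and let $g=\dfrac{b+\langle\beta,\beta\rangle_q}{c+\langle\gamma,\gamma\rangle_r}\in\tilde K_p$ be of diastasis type (that is, $g$ is a function of diastasis type that is equal to this quotient of elements of $\tilde\Lambda_p$ near $p$, off the zero set of the denominator, whose germ is not zero). Then $$e^{g}\notin \tilde\Lambda_p^{\mu}\tilde K_p\setminus\mathbb R_p .$$ In other words, if $e^g=f^\mu h$ with $f\in\tilde\Lambda_p$ and $h\in\tilde K_p$, then $e^g$, and hence $g$, is constant. -/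

import Mathlib

open Filter Topology
open scoped Manifold ContDiff

namespace Umehara

noncomputable section

variable {n : ℕ} {M : Type*} [TopologicalSpace M] [ChartedSpace (EuclideanSpace ℂ (Fin n)) M]

/-- `α` is holomorphic near the point `p` of the `n`-dimensional complex manifold `M` (complex
analytic in charts), and vanishes at `p`. -/
def IsHolVanishing (n : ℕ) {M : Type*} [TopologicalSpace M]
    [ChartedSpace (EuclideanSpace ℂ (Fin n)) M] (p : M) (α : M → ℂ) : Prop :=
  ContMDiffAt 𝓘(ℂ, EuclideanSpace ℂ (Fin n)) 𝓘(ℂ) ω α p ∧ α p = 0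

/-- The indefinite Hermitian square `⟨α, α⟩_ℓ = ∑_{j ≤ ℓ} |α_j|² - ∑_{j > ℓ} |α_j|²`. -/
def hermSq {M : Type*} {m : ℕ} (ℓ : ℕ) (α : Fin m → M → ℂ) (x : M) : ℝ :=
  ∑ j : Fin m, if (j : ℕ) < ℓ then ‖α j x‖ ^ 2 else -‖α j x‖ ^ 2

/-- The germ `u` at `p` is of the form `a + ⟨α, α⟩_ℓ` with `a` real and `α = (α_1, …, α_m)`,
`m ≥ 1`, `ℓ ≤ m`, holomorphic germs vanishing at `p`. -/
def IsDiastasisForm (n : ℕ) {M : Type*} [TopologicalSpace M]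
    [ChartedSpace (EuclideanSpace ℂ (Fin n)) M] (p : M) (u : Germ (𝓝 p) ℝ) : Prop :=
  ∃ (a : ℝ) (m ℓ : ℕ) (α : Fin m → M → ℂ), 1 ≤ m ∧ ℓ ≤ m ∧ (∀ j, IsHolVanishing n p (α j)) ∧
    u = ((fun x => a + hermSq ℓ α x : M → ℝ) : Germ (𝓝 p) ℝ)

theorem IsHolVanishing.const_mul {p : M} {α : M → ℂ} (h : IsHolVanishing n p α) (c : ℂ) :
    IsHolVanishing n p (fun x => c * α x) :=
  ⟨contMDiffAt_const.mul h.1, by simp [h.2]⟩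

theorem IsHolVanishing.mul {p : M} {α β : M → ℂ} (h : IsHolVanishing n p α)
    (h' : IsHolVanishing n p β) : IsHolVanishing n p (fun x => α x * β x) :=
  ⟨h.1.mul h'.1, by simp [h.2]⟩

theorem isHolVanishing_zero (p : M) : IsHolVanishing n p (fun _ => 0) :=
  ⟨contMDiffAt_const, rfl⟩

/-- Sums with arbitrary real weights can be brought to the normal form. -/
theorem isDiastasisForm_of_fintype {p : M} {ι : Type*} [Fintype ι] (a : ℝ) (s : ι → ℝ)
    (α : ι → M → ℂ) (hα : ∀ i, IsHolVanishing n p (α i)) :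
    IsDiastasisForm n p ((fun x => a + ∑ i, s i * ‖α i x‖ ^ 2 : M → ℝ) : Germ (𝓝 p) ℝ) := by
  classical
  let k := Fintype.card ι
  let e : Fin k ≃ ι := (Fintype.equivFin ι).symm
  let P : Fin k → M → ℂ := fun i x => (Real.sqrt (max (s (e i)) 0) : ℂ) * α (e i) x
  let N : Fin k → M → ℂ := fun i x => (Real.sqrt (max (-s (e i)) 0) : ℂ) * α (e i) x
  let N' : Fin (k + 1) → M → ℂ := Fin.snoc N (fun _ => 0)
  refine ⟨a, k + (k + 1), k, Fin.append P N', by omega, by omega, ?_, ?_⟩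
  · intro j
    refine Fin.addCases (fun i => ?_) (fun i => ?_) j
    · rw [Fin.append_left]
      exact (hα _).const_mul _
    · rw [Fin.append_right]
      refine Fin.lastCases ?_ (fun i => ?_) i
      · simpa [N'] using isHolVanishing_zero p
      · simpa [N'] using (hα _).const_mul _
  · congr 1
    funext x
    have key : ∀ i, s i = max (s i) 0 - max (-s i) 0 := fun i => by
      rcases le_total 0 (s i) with h | h
      · rw [max_eq_left h, max_eq_right (by linarith)]; ring
      · rw [max_eq_right h, max_eq_left (by linarith)]; ring
    have hnorm : ∀ (t : ℝ) (z : ℂ), ‖(Real.sqrt (max t 0) : ℂ) * z‖ ^ 2 = max t 0 * ‖z‖ ^ 2 := by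
      intro t z
      rw [norm_mul, mul_pow, Complex.norm_real, Real.norm_of_nonneg (Real.sqrt_nonneg _),
        Real.sq_sqrt (le_max_right _ _)]
    unfold hermSq
    rw [Fin.sum_univ_add, Fin.sum_univ_castSucc, ← Equiv.sum_comp e]
    simp only [Fin.append_left, Fin.append_right, Fin.val_castAdd, Fin.val_natAdd, Fin.is_lt,
      if_true, N', Fin.snoc_castSucc, Fin.snoc_last, P, N, hnorm]
    have : ∀ m : ℕ, ¬ k + m < k := fun m => by omega
    simp only [this, if_false, norm_zero]
    have h2 : ∀ i : Fin k, s (e i) * ‖α (e i) x‖ ^ 2 =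
        max (s (e i)) 0 * ‖α (e i) x‖ ^ 2 + -(max (-s (e i)) 0 * ‖α (e i) x‖ ^ 2) := fun i => by
      conv_lhs => rw [key (e i)]
      ring
    rw [Finset.sum_congr rfl fun i _ => h2 i, Finset.sum_add_distrib]
    ring

theorem hermSq_eq {M : Type*} {m : ℕ} (ℓ : ℕ) (α : Fin m → M → ℂ) (x : M) :
    hermSq ℓ α x = ∑ j : Fin m, (if (j : ℕ) < ℓ then (1 : ℝ) else -1) * ‖α j x‖ ^ 2 := by
  unfold hermSq
  exact Finset.sum_congr rfl fun j _ => by split_ifs <;> ring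

theorem isDiastasisForm_const (p : M) (c : ℝ) :
    IsDiastasisForm n p ((fun _ => c : M → ℝ) : Germ (𝓝 p) ℝ) := by
  simpa using isDiastasisForm_of_fintype (n := n) (p := p) (ι := Empty) c (fun _ => 0)
    (fun _ _ => 0) (fun _ => isHolVanishing_zero p)

/-- The algebra `Λ̃_p` of the germs at `p` of the form `a + ⟨α, α⟩_ℓ`, as a subring (containing the
real constants) of the ring of germs at `p` of real functions. -/
def lambdaTilde (n : ℕ) {M : Type*} [TopologicalSpace M]
    [ChartedSpace (EuclideanSpace ℂ (Fin n)) M] (p : M) : Subring (Germ (𝓝 p) ℝ) where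
  carrier := {u | IsDiastasisForm n p u}
  zero_mem' := isDiastasisForm_const p 0
  one_mem' := isDiastasisForm_const p 1
  neg_mem' := by
    rintro _ ⟨a, m, ℓ, α, -, -, hα, rfl⟩
    change IsDiastasisForm n p _
    convert isDiastasisForm_of_fintype (-a)
      (fun j : Fin m => -(if (j : ℕ) < ℓ then (1 : ℝ) else -1)) α hα using 1
    change ((_ : M → ℝ) : Germ (𝓝 p) ℝ) = _
    congr 1
    funext x
    simp only [Function.comp_apply, hermSq_eq, neg_add, neg_mul, Finset.sum_neg_distrib]
  add_mem' := by
    rintro _ _ ⟨a, m, ℓ, α, -, -, hα, rfl⟩ ⟨b, m', ℓ', β, -, -, hβ, rfl⟩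
    change IsDiastasisForm n p _
    convert isDiastasisForm_of_fintype (a + b)
      (Sum.elim (fun j : Fin m => if (j : ℕ) < ℓ then (1 : ℝ) else -1)
        (fun j : Fin m' => if (j : ℕ) < ℓ' then (1 : ℝ) else -1)) (Sum.elim α β)
      (by rintro (i | i); exacts [hα i, hβ i]) using 1
    change ((_ : M → ℝ) : Germ (𝓝 p) ℝ) = _
    congr 1
    funext x
    simp only [hermSq_eq, Fintype.sum_sum_type, Sum.elim_inl, Sum.elim_inr]
    ring
  mul_mem' := by
    rintro _ _ ⟨a, m, ℓ, α, -, -, hα, rfl⟩ ⟨b, m', ℓ', β, -, -, hβ, rfl⟩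
    let s : Fin m → ℝ := fun j => if (j : ℕ) < ℓ then (1 : ℝ) else -1
    let t : Fin m' → ℝ := fun j => if (j : ℕ) < ℓ' then (1 : ℝ) else -1
    change IsDiastasisForm n p _
    convert isDiastasisForm_of_fintype (a * b)
      (Sum.elim (fun j => b * s j) (Sum.elim (fun j => a * t j) (fun q => s q.1 * t q.2)))
      (Sum.elim α (Sum.elim β (fun (q : Fin m × Fin m') x => α q.1 x * β q.2 x)))
      (by rintro (i | i | q); exacts [hα i, hβ i, (hα q.1).mul (hβ q.2)]) using 1
    change ((_ : M → ℝ) : Germ (𝓝 p) ℝ) = _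
    congr 1
    funext x
    have h : ∑ q : Fin m × Fin m', s q.1 * t q.2 * ‖α q.1 x * β q.2 x‖ ^ 2 =
        (∑ j, s j * ‖α j x‖ ^ 2) * ∑ j, t j * ‖β j x‖ ^ 2 := by
      rw [Finset.sum_mul_sum, ← Finset.univ_product_univ, Finset.sum_product]
      refine Finset.sum_congr rfl fun i _ => Finset.sum_congr rfl fun j _ => ?_
      rw [norm_mul]; ring
    simp only [hermSq_eq, Fintype.sum_sum_type, Sum.elim_inl, Sum.elim_inr]
    rw [h]
    simp only [mul_assoc, ← Finset.mul_sum]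
    ring

/-- An element of `Λ̃_p` is real analytic in the preferred chart at `p`. -/
theorem exists_analyticAt_of_mem {p : M} {u : Germ (𝓝 p) ℝ} (hu : u ∈ lambdaTilde n p) :
    ∃ F : EuclideanSpace ℂ (Fin n) → ℝ, AnalyticAt ℝ F (chartAt (EuclideanSpace ℂ (Fin n)) p p) ∧
      u = ((fun x => F (chartAt (EuclideanSpace ℂ (Fin n)) p x) : M → ℝ) : Germ (𝓝 p) ℝ) := by
  obtain ⟨a, m, ℓ, α, -, -, hα, rfl⟩ := hu
  set φ := chartAt (EuclideanSpace ℂ (Fin n)) p with hφ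
  have han : ∀ j, AnalyticAt ℝ (fun z => α j (φ.symm z)) (φ p) := by
    intro j
    have h := (contMDiffAt_iff.1 (hα j).1).2
    simp only [mfld_simps, Function.comp_def, chartAt_self_eq] at h
    have h' : ContDiffAt ℂ ω (fun z => α j (φ.symm z)) (φ p) := contDiffWithinAt_univ.1 h
    exact h'.analyticAt.restrictScalars
  refine ⟨fun z => a + ∑ j : Fin m, (if (j : ℕ) < ℓ then (1 : ℝ) else -1) *
    ‖α j (φ.symm z)‖ ^ 2, ?_, ?_⟩
  · refine analyticAt_const.add (Finset.analyticAt_fun_sum _ fun j _ => analyticAt_const.mul ?_)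
    have hre : AnalyticAt ℝ (fun z => (α j (φ.symm z)).re) (φ p) :=
      (Complex.reCLM.analyticAt _).comp (han j)
    have him : AnalyticAt ℝ (fun z => (α j (φ.symm z)).im) (φ p) :=
      (Complex.imCLM.analyticAt _).comp (han j)
    convert (hre.pow 2).add (him.pow 2) using 1
    funext z
    rw [← Complex.normSq_eq_norm_sq, Complex.normSq_apply]
    exact congrArg₂ (· + ·) (sq _).symm (sq _).symm
  · refine Germ.coe_eq.2 ?_
    filter_upwards [φ.open_source.mem_nhds (mem_chart_source _ p)] with x hx
    simp only [hermSq_eq, φ.left_inv hx]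

/-- The ring of germs of real analytic functions has no zero divisors. -/
theorem eventually_zero_or_of_mul {E : Type*} [NormedAddCommGroup E] [NormedSpace ℝ E]
    {F G : E → ℝ} {z : E} (hF : AnalyticAt ℝ F z) (hG : AnalyticAt ℝ G z)
    (h : ∀ᶠ y in 𝓝 z, F y * G y = 0) : (∀ᶠ y in 𝓝 z, F y = 0) ∨ ∀ᶠ y in 𝓝 z, G y = 0 := by
  obtain ⟨r, hr, hb⟩ := Metric.eventually_nhds_iff_ball.1
    (hF.eventually_analyticAt.and (hG.eventually_analyticAt.and h))
  by_cases hz : ∀ y ∈ Metric.ball z r, F y = 0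
  · exact Or.inl (Filter.mem_of_superset (Metric.ball_mem_nhds z hr) hz)
  · push Not at hz
    obtain ⟨y, hy, hne⟩ := hz
    have hGy : G =ᶠ[𝓝 y] 0 := by
      filter_upwards [(hb y hy).1.continuousAt.eventually_ne hne,
        Metric.isOpen_ball.mem_nhds hy] with w hw hwb
      exact (mul_eq_zero.1 (hb w hwb).2.2).resolve_left hw
    have hG0 := AnalyticOnNhd.eqOn_zero_of_preconnected_of_eventuallyEq_zero
      (fun w hw => (hb w hw).2.1) (convex_ball z r).isPreconnected hy hGy
    exact Or.inr (Filter.mem_of_superset (Metric.ball_mem_nhds z hr) hG0)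

instance instIsDomainLambdaTilde (p : M) : IsDomain (lambdaTilde n p) := by
  have hnz : NoZeroDivisors (lambdaTilde n p) := ⟨by
    rintro ⟨u, hu⟩ ⟨v, hv⟩ huv
    have huv' : u * v = 0 := congrArg Subtype.val huv
    obtain ⟨F, hF, rfl⟩ := exists_analyticAt_of_mem hu
    obtain ⟨G, hG, rfl⟩ := exists_analyticAt_of_mem hv
    set φ := chartAt (EuclideanSpace ℂ (Fin n)) p with hφ
    have hp : p ∈ φ.source := mem_chart_source _ p
    have h0 : ∀ᶠ x in 𝓝 p, F (φ x) * G (φ x) = 0 := Germ.coe_eq.1 huv'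
    have h1 : ∀ᶠ z in 𝓝 (φ p), F z * G z = 0 := by
      rw [← φ.map_nhds_eq hp]
      exact h0
    have hc := φ.continuousAt hp
    rcases eventually_zero_or_of_mul hF hG h1 with h | h
    · exact Or.inl (Subtype.ext (Germ.coe_eq.2 (hc.eventually h)))
    · exact Or.inr (Subtype.ext (Germ.coe_eq.2 (hc.eventually h)))⟩
  have : Nontrivial (lambdaTilde n p) := inferInstance
  exact NoZeroDivisors.to_isDomain _

/-- `K̃_p`, the field of fractions of `Λ̃_p`. -/
abbrev KTilde (n : ℕ) {M : Type*} [TopologicalSpace M]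
    [ChartedSpace (EuclideanSpace ℂ (Fin n)) M] (p : M) : Type _ :=
  FractionRing (lambdaTilde n p)

/-- `k = N / D` in `K̃_p`, where the functions `N` and `D` have germs in `Λ̃_p` and the germ of `D`
is not zero. -/
def IsQuotient {p : M} (k : KTilde n p) (N D : M → ℝ) : Prop :=
  ∃ (hN : (N : Germ (𝓝 p) ℝ) ∈ lambdaTilde n p) (hD : (D : Germ (𝓝 p) ℝ) ∈ lambdaTilde n p),
    (D : Germ (𝓝 p) ℝ) ≠ 0 ∧
      k = algebraMap (lambdaTilde n p) (KTilde n p) ⟨N, hN⟩ /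
        algebraMap (lambdaTilde n p) (KTilde n p) ⟨D, hD⟩

/-- The function `u`, defined near `p`, is given there by the quotient `k ∈ K̃_p` (off the zero set
of the denominator). -/
def IsGivenBy {p : M} (u : M → ℝ) (k : KTilde n p) : Prop :=
  ∃ N D : M → ℝ, IsQuotient k N D ∧ ∀ᶠ x in 𝓝 p, D x ≠ 0 → u x = N x / D x

/-- `u` is of diastasis type at `p`: it is real analytic near `p`, i.e. in some complex coordinates
`z` of `M` centered at `p` it is the sum `∑ a_{jk} z^j z̄^k` of a convergent power series in `z` and
`z̄`, and this series has no terms `z^j` or `z̄^j` with `j ≠ 0`. -/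
def IsDiastasisType (n : ℕ) {M : Type*} [TopologicalSpace M]
    [ChartedSpace (EuclideanSpace ℂ (Fin n)) M] (p : M) (u : M → ℝ) : Prop :=
  ∃ φ ∈ IsManifold.maximalAtlas 𝓘(ℂ, EuclideanSpace ℂ (Fin n)) ω M, p ∈ φ.source ∧ φ p = 0 ∧
    ∃ a : (Fin n → ℕ) → (Fin n → ℕ) → ℂ, (∀ j, j ≠ 0 → a j 0 = 0 ∧ a 0 j = 0) ∧
      ∀ᶠ x in 𝓝 p, HasSum (fun q : (Fin n → ℕ) × (Fin n → ℕ) =>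
        a q.1 q.2 * (∏ i, φ x i ^ q.1 i) * ∏ i, (starRingEnd ℂ) (φ x i) ^ q.2 i) (u x : ℂ)

/-- The set `Λ̃_p^μ K̃_p` of the products `f ^ μ h` with `f ∈ Λ̃_p` and `h = N / D ∈ K̃_p`, as a set of
germs at `p` of real functions. The real power `f ^ μ` is taken on the open set where `f > 0`, which
has to accumulate at `p`, and the germ has to agree with `f ^ μ h` at the points of this set near `p`
where `D` does not vanish. -/
def powMul (n : ℕ) {M : Type*} [TopologicalSpace M]
    [ChartedSpace (EuclideanSpace ℂ (Fin n)) M] (p : M) (μ : ℝ) : Set (Germ (𝓝 p) ℝ) :=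
  {w | ∃ (f W : M → ℝ) (h : KTilde n p) (N D : M → ℝ),
    (f : Germ (𝓝 p) ℝ) ∈ lambdaTilde n p ∧ IsQuotient h N D ∧ w = (W : Germ (𝓝 p) ℝ) ∧
      (∃ᶠ x in 𝓝 p, 0 < f x) ∧
      ∀ᶠ x in 𝓝 p, 0 < f x → D x ≠ 0 → W x = f x ^ μ * (N x / D x)}

/-- `ℝ_p`, the germs at `p` of the real constants. -/
def constGerms {M : Type*} [TopologicalSpace M] (p : M) : Set (Germ (𝓝 p) ℝ) :=
  Set.range fun c : ℝ => ((fun _ => c : M → ℝ) : Germ (𝓝 p) ℝ)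

end

end Umehara

/-! In a chart centered at `p`, restrict to complex lines `s ↦ s • v` and write `g = B / C`.
Applying the `(1,0)`-derivative to the logarithm of `e^g = f^μ N / D` and clearing denominators
gives an identity that is real analytic and free of real powers, so it extends from the open set
where `f > 0` to the whole ball. Polarization (`eq_zero_of_forall_conj`) then makes the conjugate
variable an independent variable `w`: `∂_z (B/C)` equals a combination, with coefficients `μ, 1,
-1`, of the logarithmic derivatives in `z` of `f`, `N`, `D`.

The claim is that `∂_z (B/C)` does not depend on `w` (`exists_deriv_eq_const_mul`). All functions
involved are linear in a vector `y = β(w)` with finitely many entries, so for fixed `z` the identity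
is polynomial in `y` and holds on the Zariski closure of the curve `β`, an irreducible affine
variety. For generic `y` there, a pole of `B/C` in `z` would give its derivative a pole of order at
least two, while logarithmic derivatives have at most simple poles; hence `B/C` is holomorphic in
`z` (`exists_differentiableOn_eq_mul`). Its derivative is bounded uniformly in `y`, by compactness
of unit spheres and the maximum principle (`exists_bound_of_logDeriv`). A bounded rational function
on an irreducible affine variety is constant (`exists_sub_C_mul_mem_of_bounded`), so `∂_z (B/C)` is
constant in `y`.

Let `H(z, w)` be the polarization of `g` on the line. Then `H(z, w₁) - H(z, w₂)` is constant in `z`.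
The diastasis condition says that `H` is constant on both axes: at `z = 0` this difference vanishes,
so `H(z, w) = H(z, 0) = H(0, 0)`. -/

namespace Umehara

/-! ### Bounded rational functions on irreducible affine varieties -/

open MvPolynomial in
/-- A rational function which is bounded on a dense open part of an irreducible affine variety over
`ℂ` is constant. -/
theorem exists_sub_C_mul_mem_of_bounded {ι : Type*} [Finite ι] {P : Ideal (MvPolynomial ι ℂ)}
    [P.IsPrime] {p q e : MvPolynomial ι ℂ} (hq : q ∉ P) (he : e ∉ P) (M : ℝ)
    (h : ∀ y ∈ zeroLocus ℂ P, aeval y e ≠ 0 → ‖aeval y p‖ ≤ M * ‖aeval y q‖) :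
    ∃ c : ℂ, p - C c * q ∈ P := by
  let A := MvPolynomial ι ℂ ⧸ P
  let K := FractionRing A
  let π : MvPolynomial ι ℂ →ₐ[ℂ] K := (IsScalarTower.toAlgHom ℂ A K).comp (Ideal.Quotient.mkₐ ℂ P)
  have hπ : ∀ a, π a = 0 ↔ a ∈ P := by
    intro a
    change algebraMap A K (Ideal.Quotient.mk P a) = 0 ↔ _
    rw [IsFractionRing.to_map_eq_zero_iff, Ideal.Quotient.eq_zero_iff_mem]
  have hq0 : π q ≠ 0 := fun h' => hq ((hπ q).1 h')
  have he0 : π e ≠ 0 := fun h' => he ((hπ e).1 h')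
  have hC : ∀ c : ℂ, π (C c) = algebraMap ℂ K c := fun c => π.commutes c
  set x : K := π p / π q with hx
  -- In the function field `K`, an element algebraic over `ℂ` is a scalar. A transcendental `x` is
  -- excluded below by counting dimensions.
  by_cases halg : IsAlgebraic ℂ x
  · have hi : IsIntegral ℂ x := halg.isIntegral
    obtain ⟨c, hc⟩ := minpoly.mem_range_of_degree_eq_one ℂ x
      (IsAlgClosed.degree_eq_one_of_irreducible ℂ (minpoly.irreducible hi))
    refine ⟨c, (hπ _).1 ?_⟩
    rw [map_sub, map_mul, hC, hc, hx, div_mul_cancel₀ _ hq0, sub_self]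
  exfalso
  have htr : Transcendental ℂ x := halg
  -- `W` is the coordinate ring with `q * e` inverted; it has countable dimension over `ℂ`.
  let S : Set K := Set.range fun s : (ι →₀ ℕ) × ℕ => π (monomial s.1 1) / π (q * e) ^ s.2
  let W : Submodule ℂ K := Submodule.span ℂ S
  have hS : S.Countable := Set.countable_range _
  have hmem : ∀ (r : MvPolynomial ι ℂ) (k : ℕ), π r / π (q * e) ^ k ∈ W := by
    intro r k
    induction r using MvPolynomial.induction_on' with
    | monomial s c =>
      have : π (monomial s c) / π (q * e) ^ k = c • (π (monomial s 1) / π (q * e) ^ k) := by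
        rw [← mul_one c, ← smul_eq_mul, ← smul_monomial, map_smul, smul_eq_mul, mul_one,
          smul_div_assoc]
      rw [this]
      exact W.smul_mem _ (Submodule.subset_span ⟨(s, k), rfl⟩)
    | add a b ha hb => rw [map_add, add_div]; exact W.add_mem ha hb
  -- The bound prevents `p / q` from taking the value `c` where `q * e ≠ 0`, so `q * e` vanishes on
  -- the zeros of `P + (p - c q)`. By the Nullstellensatz a power of `q * e` is a multiple of `p - c
  -- q` modulo `P`.
  have hinv : ∀ c : {c : ℂ // M < ‖c‖}, (x - algebraMap ℂ K c)⁻¹ ∈ W := by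
    rintro ⟨c, hc⟩
    let I : Ideal (MvPolynomial ι ℂ) := P ⊔ Ideal.span {p - C c * q}
    have hv : q * e ∈ vanishingIdeal ℂ (zeroLocus ℂ I) := by
      intro y hy
      have hyP : y ∈ zeroLocus ℂ P := zeroLocus_anti_mono le_sup_left hy
      have hy2 : aeval y (p - C c * q) = 0 :=
        hy _ ((le_sup_right : _ ≤ I) (Ideal.mem_span_singleton_self _))
      rw [map_sub, map_mul, sub_eq_zero, aeval_C] at hy2
      rw [map_mul]
      by_contra hne
      have h1 := h y hyP (right_ne_zero_of_mul hne)
      have h2 : 0 < ‖aeval y q‖ := norm_pos_iff.2 (left_ne_zero_of_mul hne)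
      rw [hy2, norm_mul] at h1
      have h3 : ‖c‖ ≤ M := le_of_mul_le_mul_right h1 h2
      exact absurd hc (not_lt.2 h3)
    rw [vanishingIdeal_zeroLocus_eq_radical] at hv
    obtain ⟨k, hk⟩ := hv
    obtain ⟨a, ha, b, hb, hab⟩ := Submodule.mem_sup.1 hk
    obtain ⟨r, rfl⟩ := Ideal.mem_span_singleton'.1 hb
    have h4 : π r * (π p - algebraMap ℂ K c * π q) = π (q * e) ^ k := by
      rw [← map_pow, ← hab, map_add, (hπ a).2 ha, zero_add, map_mul, map_sub, map_mul, hC]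
    have h5 : π (q * e) ^ k ≠ 0 := pow_ne_zero _ (by rw [map_mul]; exact mul_ne_zero hq0 he0)
    have h6 : (x - algebraMap ℂ K c)⁻¹ = π (r * q) / π (q * e) ^ k := by
      have h7 : π p - algebraMap ℂ K c * π q ≠ 0 := by
        rintro h8; rw [h8, mul_zero] at h4; exact h5 h4.symm
      have h8 : x - algebraMap ℂ K c = (π p - algebraMap ℂ K c * π q) / π q := by
        rw [hx, sub_div, mul_div_cancel_right₀ _ hq0]
      rw [h8, inv_div, ← h4, map_mul]
      have h9 : π r ≠ 0 := by
        rintro h8; rw [h8, zero_mul] at h4; exact h5 h4.symm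
      rw [mul_div_mul_left _ _ h9]
    rw [h6]
    exact hmem _ _
  -- For transcendental `x` these inverses are independent, and there is a continuum of admissible
  -- `c`: too many for `W`.
  have hli : LinearIndependent ℂ fun c : {c : ℂ // M < ‖c‖} =>
      (⟨(x - algebraMap ℂ K c)⁻¹, hinv c⟩ : W) := by
    refine LinearIndependent.of_comp W.subtype ?_
    exact htr.linearIndependent_sub_inv.comp _ Subtype.val_injective
  have h1 := hli.cardinal_lift_le_rank
  have h2 : Module.rank ℂ W ≤ Cardinal.aleph0 :=
    (rank_span_le S).trans hS.le_aleph0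
  have h3 : Cardinal.mk {c : ℂ // M < ‖c‖} ≤ Cardinal.aleph0 := by
    have := h1.trans (Cardinal.lift_le.2 h2)
    simpa using this
  have hopen : IsOpen {c : ℂ | M < ‖c‖} := isOpen_lt continuous_const continuous_norm
  have hne : {c : ℂ | M < ‖c‖}.Nonempty := by
    refine ⟨((|M| + 1 : ℝ) : ℂ), ?_⟩
    rw [Set.mem_ofPred_eq, Complex.norm_real, Real.norm_eq_abs]
    have := le_abs_self M
    have := le_abs_self (|M| + 1)
    linarith
  have h4 := continuum_le_cardinal_of_isOpen ℂ hopen hne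
  exact absurd (h4.trans h3) (not_le.2 Cardinal.aleph0_lt_continuum)

/-! ### Isolated zeros, and poles of logarithmic derivatives -/

theorem eventually_ne_zero_of_isPreconnected {U : Set ℂ} (hU : IsOpen U) (hc : IsPreconnected U)
    {g : ℂ → ℂ} (hg : DifferentiableOn ℂ g U) (h0 : ∃ z ∈ U, g z ≠ 0) {z : ℂ} (hz : z ∈ U) :
    ∀ᶠ x in 𝓝[≠] z, g x ≠ 0 := by
  have ha := hg.analyticOnNhd hU
  rcases (ha z hz).eventually_eq_zero_or_eventually_ne_zero with h | h
  · obtain ⟨w, hw, hne⟩ := h0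
    exact absurd (ha.eqOn_zero_of_preconnected_of_eventuallyEq_zero hc hz h hw) hne
  · exact h

/-- The zeros of `h` are isolated, so the identity theorem fills them in. This is how denominators
are cancelled throughout without excluding their zeros. -/
theorem eqOn_of_mul_eq_mul {U : Set ℂ} (hU : IsOpen U) (hc : IsPreconnected U)
    {f g h : ℂ → ℂ} (hf : DifferentiableOn ℂ f U) (hg : DifferentiableOn ℂ g U)
    (hh : DifferentiableOn ℂ h U) (h0 : ∃ z ∈ U, h z ≠ 0)
    (heq : ∀ z ∈ U, h z * f z = h z * g z) : ∀ z ∈ U, f z = g z := by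
  intro z hz
  have h1 : ∀ᶠ x in 𝓝[≠] z, f x = g x := by
    filter_upwards [eventually_ne_zero_of_isPreconnected hU hc hh h0 hz,
      nhdsWithin_le_nhds (hU.mem_nhds hz)] with x hx hxU
    exact mul_left_cancel₀ hx (heq x hxU)
  exact (((hf.analyticOnNhd hU z hz).frequently_eq_iff_eventually_eq
    (hg.analyticOnNhd hU z hz)).1 h1.frequently).self_of_nhds

/-- The numerator of the logarithmic derivative of `D / (f ^ μ * N)`. -/
noncomputable def logNum (μ : ℂ) (D N f : ℂ → ℂ) (z : ℂ) : ℂ :=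
  deriv D z * f z * N z - μ * deriv f z * D z * N z - deriv N z * D z * f z

theorem neg_one_le_meromorphicOrderAt_logDeriv {g : ℂ → ℂ} {z : ℂ} (hg : MeromorphicAt g z)
    (h : meromorphicOrderAt g z ≠ ⊤) : -1 ≤ meromorphicOrderAt (logDeriv g) z := by
  by_cases h0 : meromorphicOrderAt g z = 0
  · exact le_trans (by decide) (meromorphicOrderAt_logDeriv_nonneg hg h0)
  · exact (meromorphicOrderAt_logDeriv_eq_neg_one hg h0 h).ge

/-- A quotient of holomorphic functions whose derivative is a combination of logarithmic derivatives
has no poles. -/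
theorem exists_differentiableOn_eq_mul {U : Set ℂ} (hU : IsOpen U) (hc : IsPreconnected U) {μ : ℂ}
    {B C D N f : ℂ → ℂ} (hB : DifferentiableOn ℂ B U) (hC : DifferentiableOn ℂ C U)
    (hD : DifferentiableOn ℂ D U) (hN : DifferentiableOn ℂ N U) (hf : DifferentiableOn ℂ f U)
    (hC0 : ∃ z ∈ U, C z ≠ 0) (hD0 : ∃ z ∈ U, D z ≠ 0) (hN0 : ∃ z ∈ U, N z ≠ 0)
    (hf0 : ∃ z ∈ U, f z ≠ 0)
    (hI : ∀ z ∈ U, (deriv B z * C z - B z * deriv C z) * (D z * N z * f z) +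
      C z ^ 2 * logNum μ D N f z = 0) :
    ∃ k : ℂ → ℂ, DifferentiableOn ℂ k U ∧ ∀ z ∈ U, B z = k z * C z := by
  have an : ∀ {g : ℂ → ℂ}, DifferentiableOn ℂ g U → ∀ z ∈ U, AnalyticAt ℂ g z :=
    fun hg z hz => hg.analyticOnNhd hU z hz
  set h : ℂ → ℂ := fun z => B z / C z with hh
  have hmer : MeromorphicOn h U := fun z hz => (an hB z hz).meromorphicAt.div (an hC z hz).meromorphicAt
  have hne : ∀ {g : ℂ → ℂ}, DifferentiableOn ℂ g U → (∃ z ∈ U, g z ≠ 0) → ∀ z ∈ U,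
      meromorphicOrderAt g z ≠ ⊤ := fun hg h0 z hz =>
    (meromorphicOrderAt_ne_top_iff_eventually_ne_zero (an hg z hz).meromorphicAt).2
      (eventually_ne_zero_of_isPreconnected hU hc hg h0 hz)
  have hord : ∀ z ∈ U, 0 ≤ meromorphicOrderAt h z := by
    intro z hz
    by_contra hlt
    rw [not_le] at hlt
    obtain ⟨n, hn⟩ := WithTop.ne_top_iff_exists.1 hlt.ne_top
    rw [← hn] at hlt
    have hn0 : n < 0 := by exact_mod_cast hlt
    -- At a pole, `n ≤ -1`, so the derivative has order at most `-2`; the right-hand side of `h2`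
    -- has order at least `-1`.
    have h1 : meromorphicOrderAt (deriv h) z = ((n - 1 : ℤ) : WithTop ℤ) :=
      meromorphicOrderAt_deriv_eq_sub_one (by exact_mod_cast hn0.ne) hn.symm
    have mf := (an hf z hz).meromorphicAt
    have mN := (an hN z hz).meromorphicAt
    have mD := (an hD z hz).meromorphicAt
    have ml : ∀ {g : ℂ → ℂ}, MeromorphicAt g z → MeromorphicAt (logDeriv g) z :=
      fun hg => hg.deriv.div hg
    have h2 : deriv h =ᶠ[𝓝[≠] z] ((fun _ => μ) * logDeriv f + logDeriv N) + -logDeriv D := by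
      filter_upwards [eventually_ne_zero_of_isPreconnected hU hc hC hC0 hz,
        eventually_ne_zero_of_isPreconnected hU hc hD hD0 hz,
        eventually_ne_zero_of_isPreconnected hU hc hN hN0 hz,
        eventually_ne_zero_of_isPreconnected hU hc hf hf0 hz,
        nhdsWithin_le_nhds (hU.mem_nhds hz)] with x h3 h4 h5 h6 hx
      have h7 : deriv h x = (deriv B x * C x - B x * deriv C x) / C x ^ 2 :=
        deriv_fun_div (an hB x hx).differentiableAt (an hC x hx).differentiableAt h3
      have h8 := hI x hx
      simp only [Pi.add_apply, Pi.mul_apply, Pi.neg_apply, logDeriv_apply]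
      rw [h7]
      unfold logNum at h8
      field_simp
      linear_combination h8
    have h3 : (-1 : WithTop ℤ) ≤ meromorphicOrderAt (deriv h) z := by
      rw [meromorphicOrderAt_congr h2]
      have mc : MeromorphicAt (fun _ : ℂ => μ) z := analyticAt_const.meromorphicAt
      have hcf : (-1 : WithTop ℤ) ≤ meromorphicOrderAt ((fun _ => μ) * logDeriv f) z := by
        rw [meromorphicOrderAt_mul mc (ml mf)]
        have h4 : (0 : WithTop ℤ) ≤ meromorphicOrderAt (fun _ : ℂ => μ) z :=
          analyticAt_const.meromorphicOrderAt_nonneg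
        have h5 := neg_one_le_meromorphicOrderAt_logDeriv mf (hne hf hf0 z hz)
        simpa using add_le_add h4 h5
      have hcN := neg_one_le_meromorphicOrderAt_logDeriv mN (hne hN hN0 z hz)
      have hcD : (-1 : WithTop ℤ) ≤ meromorphicOrderAt (-logDeriv D) z := by
        rw [← meromorphicOrderAt_neg]
        exact neg_one_le_meromorphicOrderAt_logDeriv mD (hne hD hD0 z hz)
      refine le_trans (le_min ?_ hcD) (meromorphicOrderAt_add ((mc.mul (ml mf)).add (ml mN)) (ml mD).neg)
      exact le_trans (le_min hcf hcN) (meromorphicOrderAt_add (mc.mul (ml mf)) (ml mN))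
    rw [h1] at h3
    have h4 : (-1 : ℤ) ≤ n - 1 := WithTop.coe_le_coe.1 h3
    omega
  -- The normal form replaces the default values of `B z / C z` at zeros of `C` by the removable
  -- limits.
  have hk : ∀ z ∈ U, AnalyticAt ℂ (toMeromorphicNFOn h U) z := by
    intro z hz
    rw [← (meromorphicNFOn_toMeromorphicNFOn h U hz).meromorphicOrderAt_nonneg_iff_analyticAt,
      meromorphicOrderAt_toMeromorphicNFOn hmer hz]
    exact hord z hz
  refine ⟨toMeromorphicNFOn h U, fun z hz => (hk z hz).differentiableAt.differentiableWithinAt,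
    fun z hz => ?_⟩
  have h1 : ∀ᶠ x in 𝓝[≠] z, B x = toMeromorphicNFOn h U x * C x := by
    filter_upwards [eventually_ne_zero_of_isPreconnected hU hc hC hC0 hz,
      hmer.toMeromorphicNFOn_eq_self_on_nhdsNE hz] with x h2 h3
    rw [h3, hh, div_mul_cancel₀ _ h2]
  exact (((an hB z hz).frequently_eq_iff_eventually_eq
    ((hk z hz).mul (an hC z hz))).1 h1.frequently).self_of_nhds

/-! ### Uniform bounds over finite-dimensional families -/

theorem logNum_smul {U : Set ℂ} (hU : IsOpen U) {μ : ℂ} {D N f D' N' f' : ℂ → ℂ} {r s t : ℂ}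
    (hD : ∀ z ∈ U, D z = r * D' z) (hN : ∀ z ∈ U, N z = s * N' z) (hf : ∀ z ∈ U, f z = t * f' z)
    {z : ℂ} (hz : z ∈ U) : logNum μ D N f z = r * s * t * logNum μ D' N' f' z := by
  have hd : ∀ {g g' : ℂ → ℂ} {r : ℂ}, (∀ z ∈ U, g z = r * g' z) → deriv g z = r * deriv g' z := by
    intro g g' r h
    have h1 : g =ᶠ[𝓝 z] fun z => r * g' z := by
      filter_upwards [hU.mem_nhds hz] with x hx using h x hx
    rw [h1.deriv_eq, deriv_const_mul_field]
  unfold logNum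
  rw [hd hD, hd hN, hd hf, hD z hz, hN z hz, hf z hz]
  ring

/-- Passing to a basis of the span makes every coefficient vector on the unit sphere give a function
that is not identically zero, as the compactness argument requires. -/
theorem exists_linearIndependent_family {U : Set ℂ} {ι : Type*} [Fintype ι]
    (a : ι → ℂ → ℂ) (ha : ∀ i, DifferentiableOn ℂ (a i) U) :
    ∃ (d : ℕ) (e : Fin d → ℂ → ℂ), (∀ j, DifferentiableOn ℂ (e j) U) ∧
      (∀ c : Fin d → ℂ, (∀ z ∈ U, ∑ j, c j * e j z = 0) → c = 0) ∧
      ∀ y : ι → ℂ, ∃ c : Fin d → ℂ, ∀ z ∈ U, ∑ i, y i * a i z = ∑ j, c j * e j z := by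
  classical
  -- Extension by zero turns linear independence of functions on `ℂ` into linear independence on
  -- `U`.
  let S : Submodule ℂ (ℂ → ℂ) := Submodule.span ℂ (Set.range fun i => U.indicator (a i))
  have : FiniteDimensional ℂ S := FiniteDimensional.span_of_finite ℂ (Set.finite_range _)
  let b := Module.finBasis ℂ S
  let V : Submodule ℂ (ℂ → ℂ) :=
    { carrier := {h | DifferentiableOn ℂ h U ∧ ∀ z ∉ U, h z = 0}
      add_mem' := fun ha hb => ⟨ha.1.add hb.1, fun z hz => by simp [ha.2 z hz, hb.2 z hz]⟩
      zero_mem' := ⟨differentiableOn_const 0, fun _ _ => rfl⟩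
      smul_mem' := fun c h hh => ⟨hh.1.const_smul c, fun z hz => by simp [hh.2 z hz]⟩ }
  have hSV : S ≤ V := by
    refine Submodule.span_le.2 ?_
    rintro _ ⟨i, rfl⟩
    exact ⟨(ha i).congr fun z hz => Set.indicator_of_mem hz _,
      fun z hz => Set.indicator_of_notMem hz _⟩
  refine ⟨_, fun j => (b j : ℂ → ℂ), fun j => (hSV (b j).2).1, fun c hcz => ?_, fun y => ?_⟩
  · have h1 : ∑ j, c j • b j = 0 := by
      refine Subtype.ext (funext fun z => ?_)
      rw [Submodule.coe_sum, Finset.sum_apply]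
      by_cases hz : z ∈ U
      · simpa using hcz z hz
      · refine Finset.sum_eq_zero fun j _ => ?_
        simp [(hSV (b j).2).2 z hz]
    exact funext (Fintype.linearIndependent_iff.1 b.linearIndependent c h1)
  · have hy : ∑ i, y i • U.indicator (a i) ∈ S :=
      S.sum_mem fun i _ => S.smul_mem _ (Submodule.subset_span ⟨i, rfl⟩)
    refine ⟨b.repr ⟨_, hy⟩, fun z hz => ?_⟩
    have h1 := congrArg (fun s : S => (s : ℂ → ℂ) z) (b.sum_repr ⟨_, hy⟩)
    simp only [Submodule.coe_sum, Finset.sum_apply, Submodule.coe_smul, Pi.smul_apply,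
      smul_eq_mul, Set.indicator_of_mem hz] at h1
    exact h1.symm

theorem deriv_sum_mul {U : Set ℂ} (hU : IsOpen U) {ι : Type*} [Fintype ι] {a : ι → ℂ → ℂ}
    (ha : ∀ i, DifferentiableOn ℂ (a i) U) (c : ι → ℂ) {z : ℂ} (hz : z ∈ U) :
    deriv (fun z => ∑ i, c i * a i z) z = ∑ i, c i * deriv (a i) z := by
  have h : ∀ i, DifferentiableAt ℂ (a i) z := fun i => (ha i).differentiableAt (hU.mem_nhds hz)
  rw [deriv_fun_sum fun i _ => (h i).const_mul _]
  simp only [deriv_const_mul_field]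

theorem differentiableOn_sum_mul {U : Set ℂ} {ι : Type*} [Fintype ι] {a : ι → ℂ → ℂ}
    (ha : ∀ i, DifferentiableOn ℂ (a i) U) (c : ι → ℂ) :
    DifferentiableOn ℂ (fun z => ∑ i, c i * a i z) U :=
  DifferentiableOn.fun_sum fun i _ => (ha i).const_mul _

theorem continuousAt_sum_mul {X : Type*} [TopologicalSpace X] {ι : Type*} [Fintype ι]
    {a : ι → ℂ → ℂ} {z : ℂ} (ha : ∀ i, ContinuousAt (a i) z) {c : X → ι → ℂ} {y : X}
    (hc : ContinuousAt c y) : ContinuousAt (fun q : X × ℂ => ∑ i, c q.1 i * a i q.2) (y, z) := by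
  refine tendsto_finsetSum _ fun i _ => ?_
  refine ContinuousAt.mul ?_ ?_
  · exact ((continuous_apply i).continuousAt.comp hc).comp (x := (y, z)) continuousAt_fst
  · exact (ha i).comp (x := (y, z)) continuousAt_snd

theorem eventually_sum_mul_ne_zero {U : Set ℂ} (hU : IsOpen U) (hc : IsPreconnected U)
    {ι : Type*} [Fintype ι] {a : ι → ℂ → ℂ} (ha : ∀ i, DifferentiableOn ℂ (a i) U)
    (hl : ∀ c : ι → ℂ, (∀ z ∈ U, ∑ j, c j * a j z = 0) → c = 0) {c : ι → ℂ}
    (hcs : c ∈ Metric.sphere (0 : ι → ℂ) 1) {z : ℂ} (hz : z ∈ U) :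
    ∀ᶠ x in 𝓝[≠] z, ∑ j, c j * a j x ≠ 0 := by
  refine eventually_ne_zero_of_isPreconnected hU hc (differentiableOn_sum_mul ha c) ?_ hz
  by_contra! h
  rw [hl c h] at hcs
  simp at hcs

theorem continuousAt_logNum {X : Type*} [TopologicalSpace X] {U : Set ℂ} (hU : IsOpen U) (μ : ℂ)
    {ι₁ ι₂ ι₃ : Type*} [Fintype ι₁] [Fintype ι₂] [Fintype ι₃]
    {a₁ : ι₁ → ℂ → ℂ} {a₂ : ι₂ → ℂ → ℂ} {a₃ : ι₃ → ℂ → ℂ}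
    (h₁ : ∀ i, DifferentiableOn ℂ (a₁ i) U) (h₂ : ∀ i, DifferentiableOn ℂ (a₂ i) U)
    (h₃ : ∀ i, DifferentiableOn ℂ (a₃ i) U) {c₁ : X → ι₁ → ℂ} {c₂ : X → ι₂ → ℂ} {c₃ : X → ι₃ → ℂ}
    {y : X} (k₁ : ContinuousAt c₁ y) (k₂ : ContinuousAt c₂ y) (k₃ : ContinuousAt c₃ y)
    {z : ℂ} (hz : z ∈ U) :
    ContinuousAt (fun q : X × ℂ => logNum μ (fun z => ∑ i, c₁ q.1 i * a₁ i z)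
      (fun z => ∑ i, c₂ q.1 i * a₂ i z) (fun z => ∑ i, c₃ q.1 i * a₃ i z) q.2) (y, z) := by
  have hUz := hU.mem_nhds hz
  have s₁ := continuousAt_sum_mul (fun i => ((h₁ i).differentiableAt hUz).continuousAt) k₁
  have s₂ := continuousAt_sum_mul (fun i => ((h₂ i).differentiableAt hUz).continuousAt) k₂
  have s₃ := continuousAt_sum_mul (fun i => ((h₃ i).differentiableAt hUz).continuousAt) k₃
  have d₁ := continuousAt_sum_mul
    (fun i => (((h₁ i).deriv hU).differentiableAt hUz).continuousAt) k₁
  have d₂ := continuousAt_sum_mul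
    (fun i => (((h₂ i).deriv hU).differentiableAt hUz).continuousAt) k₂
  have d₃ := continuousAt_sum_mul
    (fun i => (((h₃ i).deriv hU).differentiableAt hUz).continuousAt) k₃
  refine ((((d₁.mul s₃).mul s₂).sub (((continuousAt_const (y := μ)).mul d₃ |>.mul s₁).mul s₂)).sub
      ((d₂.mul s₁).mul s₃)).congr ?_
  filter_upwards [continuousAt_snd (hU.mem_nhds (show (y, z).2 ∈ U from hz))] with q hq
  unfold logNum
  rw [deriv_sum_mul hU h₁ _ hq, deriv_sum_mul hU h₂ _ hq, deriv_sum_mul hU h₃ _ hq]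
  rfl

theorem exists_closedBall_subset_of_eventually {U : Set ℂ} (hU : IsOpen U) {z : ℂ} (hz : z ∈ U)
    {p : ℂ → Prop} (hp : ∀ᶠ x in 𝓝[≠] z, p x) :
    ∃ ρ > 0, Metric.closedBall z ρ ⊆ U ∧ ∀ x ∈ Metric.sphere z ρ, p x := by
  rw [eventually_nhdsWithin_iff] at hp
  obtain ⟨ε, hε, h⟩ := Metric.nhds_basis_closedBall.mem_iff.1 (inter_mem hp (hU.mem_nhds hz))
  refine ⟨ε, hε, fun x hx => (h hx).2, fun x hx => ?_⟩
  exact (h (Metric.sphere_subset_closedBall hx)).1 (Metric.ne_of_mem_sphere hx hε.ne')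

/-- The holomorphic functions which are combinations of logarithmic derivatives of functions in given
finite dimensional spaces are locally bounded, uniformly in these functions. -/
theorem exists_bound_of_linearIndependent {U : Set ℂ} (hU : IsOpen U) (hc : IsPreconnected U) (μ : ℂ)
    {ι₁ ι₂ ι₃ : Type*} [Fintype ι₁] [Fintype ι₂] [Fintype ι₃]
    {a₁ : ι₁ → ℂ → ℂ} {a₂ : ι₂ → ℂ → ℂ} {a₃ : ι₃ → ℂ → ℂ}
    (h₁ : ∀ i, DifferentiableOn ℂ (a₁ i) U) (h₂ : ∀ i, DifferentiableOn ℂ (a₂ i) U)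
    (h₃ : ∀ i, DifferentiableOn ℂ (a₃ i) U)
    (l₁ : ∀ c : ι₁ → ℂ, (∀ z ∈ U, ∑ j, c j * a₁ j z = 0) → c = 0)
    (l₂ : ∀ c : ι₂ → ℂ, (∀ z ∈ U, ∑ j, c j * a₂ j z = 0) → c = 0)
    (l₃ : ∀ c : ι₃ → ℂ, (∀ z ∈ U, ∑ j, c j * a₃ j z = 0) → c = 0) {z₁ : ℂ} (hz₁ : z₁ ∈ U) :
    ∃ M : ℝ, ∀ y ∈ Metric.sphere (0 : ι₁ → ℂ) 1 ×ˢ Metric.sphere (0 : ι₂ → ℂ) 1 ×ˢ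
        Metric.sphere (0 : ι₃ → ℂ) 1, ∀ k : ℂ → ℂ, DifferentiableOn ℂ k U →
      (∀ z ∈ U, k z * ((∑ i, y.1 i * a₁ i z) * (∑ i, y.2.1 i * a₂ i z) * ∑ i, y.2.2 i * a₃ i z) +
        logNum μ (fun z => ∑ i, y.1 i * a₁ i z) (fun z => ∑ i, y.2.1 i * a₂ i z)
          (fun z => ∑ i, y.2.2 i * a₃ i z) z = 0) → ‖k z₁‖ ≤ M := by
  have hcomp : IsCompact (Metric.sphere (0 : ι₁ → ℂ) 1 ×ˢ Metric.sphere (0 : ι₂ → ℂ) 1 ×ˢ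
        Metric.sphere (0 : ι₃ → ℂ) 1) :=
    (isCompact_sphere _ _).prod ((isCompact_sphere _ _).prod (isCompact_sphere _ _))
  -- By compactness of the product of spheres, it suffices to bound `k z₁` for parameters near a
  -- given `y`.
  refine hcomp.induction_on (p := fun s => ∃ M : ℝ, ∀ y ∈ s, ∀ k : ℂ → ℂ, DifferentiableOn ℂ k U →
      (∀ z ∈ U, k z * ((∑ i, y.1 i * a₁ i z) * (∑ i, y.2.1 i * a₂ i z) * ∑ i, y.2.2 i * a₃ i z) +
        logNum μ (fun z => ∑ i, y.1 i * a₁ i z) (fun z => ∑ i, y.2.1 i * a₂ i z)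
          (fun z => ∑ i, y.2.2 i * a₃ i z) z = 0) → ‖k z₁‖ ≤ M) ⟨0, by simp⟩ ?_ ?_ ?_
  · rintro s t hst ⟨M, hM⟩
    exact ⟨M, fun y hy => hM y (hst hy)⟩
  · rintro s t ⟨M, hM⟩ ⟨M', hM'⟩
    refine ⟨max M M', fun y hy k hk h => ?_⟩
    rcases hy with hy | hy
    · exact (hM y hy k hk h).trans (le_max_left _ _)
    · exact (hM' y hy k hk h).trans (le_max_right _ _)
  have k₁ : ∀ y : (ι₁ → ℂ) × (ι₂ → ℂ) × (ι₃ → ℂ), ContinuousAt (fun y : (ι₁ → ℂ) × (ι₂ → ℂ) ×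
    (ι₃ → ℂ) => y.1) y := fun y => continuousAt_fst
  have k₂ : ∀ y : (ι₁ → ℂ) × (ι₂ → ℂ) × (ι₃ → ℂ), ContinuousAt (fun y : (ι₁ → ℂ) × (ι₂ → ℂ) ×
    (ι₃ → ℂ) => y.2.1) y := fun y => by fun_prop
  have k₃ : ∀ y : (ι₁ → ℂ) × (ι₂ → ℂ) × (ι₃ → ℂ), ContinuousAt (fun y : (ι₁ → ℂ) × (ι₂ → ℂ) ×
    (ι₃ → ℂ) => y.2.2) y := fun y => by fun_prop
  refine fun y hy => ?_
  have hy₁ := hy.1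
  have hy₂ := hy.2.1
  have hy₃ := hy.2.2
  -- The point `z₁` may be a zero of one of the three functions, so the bound is taken on a small
  -- circle around it that avoids their zeros.
  obtain ⟨ρ, hρ, hρU, hne⟩ := exists_closedBall_subset_of_eventually hU hz₁
    (((eventually_sum_mul_ne_zero hU hc h₁ l₁ hy₁ hz₁).and
      (eventually_sum_mul_ne_zero hU hc h₂ l₂ hy₂ hz₁)).and
      (eventually_sum_mul_ne_zero hU hc h₃ l₃ hy₃ hz₁))
  have hFc : ∀ z ∈ U, ContinuousAt (fun q : ((ι₁ → ℂ) × (ι₂ → ℂ) × (ι₃ → ℂ)) × ℂ =>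
      (∑ i, q.1.1 i * a₁ i q.2) * (∑ i, q.1.2.1 i * a₂ i q.2) * ∑ i, q.1.2.2 i * a₃ i q.2)
      (y, z) := by
    intro z hz
    have hUz := hU.mem_nhds hz
    have s₁ := continuousAt_sum_mul (fun i => ((h₁ i).differentiableAt hUz).continuousAt) (k₁ y)
    have s₂ := continuousAt_sum_mul (fun i => ((h₂ i).differentiableAt hUz).continuousAt) (k₂ y)
    have s₃ := continuousAt_sum_mul (fun i => ((h₃ i).differentiableAt hUz).continuousAt) (k₃ y)
    exact (s₁.mul s₂).mul s₃
  have hTc := fun z (hz : z ∈ U) => continuousAt_logNum hU μ h₁ h₂ h₃ (k₁ y) (k₂ y) (k₃ y) hz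
  have hSU := Metric.sphere_subset_closedBall.trans hρU
  have hyz : ∀ z : ℂ, ContinuousAt (fun z : ℂ => (y, z)) z := fun z =>
    continuousAt_const.prodMk continuousAt_id
  have hcont := fun z (hz : z ∈ Metric.sphere z₁ ρ) =>
    (((hTc z (hSU hz)).comp (f := fun z : ℂ => (y, z)) (hyz z)).div
      ((hFc z (hSU hz)).comp (f := fun z : ℂ => (y, z)) (hyz z))
      (mul_ne_zero (mul_ne_zero (hne z hz).1.1 (hne z hz).1.2)
        (hne z hz).2)).norm.continuousWithinAt (s := Metric.sphere z₁ ρ)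
  obtain ⟨M, hM⟩ := (isCompact_sphere z₁ ρ).bddAbove_image hcont
  -- `M` bounds the quotient at the given parameter; `M + 1` makes the inequality strict, so it
  -- persists for nearby parameters uniformly on the compact circle.
  have hev := (isCompact_sphere z₁ ρ).eventually_forall_of_forall_eventually
    (P := fun y z => ‖logNum μ (fun z => ∑ i, y.1 i * a₁ i z) (fun z => ∑ i, y.2.1 i * a₂ i z)
          (fun z => ∑ i, y.2.2 i * a₃ i z) z‖ < (M + 1) * ‖(∑ i, y.1 i * a₁ i z) *
            (∑ i, y.2.1 i * a₂ i z) * ∑ i, y.2.2 i * a₃ i z‖) (x₀ := y) fun z hz => by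
    refine (hTc z (hSU hz)).norm.eventually_lt (continuousAt_const.mul (hFc z (hSU hz)).norm) ?_
    have h0 := mul_ne_zero (mul_ne_zero (hne z hz).1.1 (hne z hz).1.2) (hne z hz).2
    have h1 := hM (Set.mem_image_of_mem _ hz)
    have h2 := norm_pos_iff.2 h0
    simp only [Pi.div_apply, Function.comp_apply, norm_div] at h1
    rw [div_le_iff₀ h2] at h1
    linarith
  refine ⟨_, nhdsWithin_le_nhds hev, M + 1, fun y hy k hk hkI => ?_⟩
  have hb : ∀ z ∈ Metric.sphere z₁ ρ, ‖k z‖ ≤ M + 1 := by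
    intro z hz
    have h1 := hy z hz
    rw [← norm_neg, ← eq_neg_of_add_eq_zero_left (hkI z (hSU hz)), norm_mul] at h1
    exact (lt_of_mul_lt_mul_right h1 (norm_nonneg _)).le
  -- The maximum principle carries the bound to the center; this is where holomorphy of `k` enters.
  refine Complex.norm_le_of_forall_mem_frontier_norm_le Metric.isBounded_ball
    (U := Metric.ball z₁ ρ) ?_ (fun z hz => hb z ?_) (subset_closure (Metric.mem_ball_self hρ))
  · refine DifferentiableOn.diffContOnCl (hk.mono ?_)
    exact Metric.closure_ball_subset_closedBall.trans hρU
  · exact Metric.frontier_ball_subset_sphere hz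

/-- The holomorphic functions which are combinations of logarithmic derivatives of functions in given
finite dimensional spaces are locally bounded, uniformly in these functions. -/
theorem exists_bound_of_logDeriv {U : Set ℂ} (hU : IsOpen U) (hc : IsPreconnected U) (μ : ℂ)
    {ι₁ ι₂ ι₃ : Type*} [Fintype ι₁] [Fintype ι₂] [Fintype ι₃]
    {a₁ : ι₁ → ℂ → ℂ} {a₂ : ι₂ → ℂ → ℂ} {a₃ : ι₃ → ℂ → ℂ}
    (h₁ : ∀ i, DifferentiableOn ℂ (a₁ i) U) (h₂ : ∀ i, DifferentiableOn ℂ (a₂ i) U)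
    (h₃ : ∀ i, DifferentiableOn ℂ (a₃ i) U) {z₁ : ℂ} (hz₁ : z₁ ∈ U) :
    ∃ M : ℝ, ∀ (y₁ : ι₁ → ℂ) (y₂ : ι₂ → ℂ) (y₃ : ι₃ → ℂ), (∃ z ∈ U, ∑ i, y₁ i * a₁ i z ≠ 0) →
      (∃ z ∈ U, ∑ i, y₂ i * a₂ i z ≠ 0) → (∃ z ∈ U, ∑ i, y₃ i * a₃ i z ≠ 0) →
      ∀ k : ℂ → ℂ, DifferentiableOn ℂ k U →
      (∀ z ∈ U, k z * ((∑ i, y₁ i * a₁ i z) * (∑ i, y₂ i * a₂ i z) * ∑ i, y₃ i * a₃ i z) +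
        logNum μ (fun z => ∑ i, y₁ i * a₁ i z) (fun z => ∑ i, y₂ i * a₂ i z)
          (fun z => ∑ i, y₃ i * a₃ i z) z = 0) → ‖k z₁‖ ≤ M := by
  obtain ⟨d₁, e₁, g₁, l₁, r₁⟩ := exists_linearIndependent_family a₁ h₁
  obtain ⟨d₂, e₂, g₂, l₂, r₂⟩ := exists_linearIndependent_family a₂ h₂
  obtain ⟨d₃, e₃, g₃, l₃, r₃⟩ := exists_linearIndependent_family a₃ h₃
  obtain ⟨M, hM⟩ := exists_bound_of_linearIndependent hU hc μ g₁ g₂ g₃ l₁ l₂ l₃ hz₁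
  refine ⟨M, fun y₁ y₂ y₃ n₁ n₂ n₃ k hk hI => ?_⟩
  -- The relation is homogeneous of degree one in each of the three functions, so their coefficient
  -- vectors can be normalized to the unit sphere.
  have norm_eq : ∀ {d : ℕ} {e : Fin d → ℂ → ℂ} {u : ℂ → ℂ}, (∃ c : Fin d → ℂ, ∀ z ∈ U,
      u z = ∑ j, c j * e j z) → (∃ z ∈ U, u z ≠ 0) → ∃ (r : ℂ) (c : Fin d → ℂ), r ≠ 0 ∧
      c ∈ Metric.sphere (0 : Fin d → ℂ) 1 ∧ ∀ z ∈ U, u z = r * ∑ j, c j * e j z := by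
    rintro d e u ⟨c, hcu⟩ ⟨z, hz, hne⟩
    have hc0 : c ≠ 0 := by rintro rfl; exact hne (by simp [hcu z hz])
    have hr : (‖c‖ : ℂ) ≠ 0 := by exact_mod_cast norm_ne_zero_iff.2 hc0
    refine ⟨‖c‖, (‖c‖ : ℂ)⁻¹ • c, hr, ?_, fun z hz => ?_⟩
    · rw [mem_sphere_zero_iff_norm, norm_smul, norm_inv, Complex.norm_real, norm_norm,
        inv_mul_cancel₀ (norm_ne_zero_iff.2 hc0)]
    · rw [hcu z hz, Finset.mul_sum]
      refine Finset.sum_congr rfl fun j _ => ?_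
      rw [Pi.smul_apply, smul_eq_mul, mul_assoc, mul_inv_cancel_left₀ hr]
  obtain ⟨s₁, c₁, hs₁, hc₁, w₁⟩ := norm_eq (r₁ y₁) n₁
  obtain ⟨s₂, c₂, hs₂, hc₂, w₂⟩ := norm_eq (r₂ y₂) n₂
  obtain ⟨s₃, c₃, hs₃, hc₃, w₃⟩ := norm_eq (r₃ y₃) n₃
  refine hM (c₁, c₂, c₃) ⟨hc₁, hc₂, hc₃⟩ k hk fun z hz => ?_
  have h1 := hI z hz
  rw [logNum_smul hU w₁ w₂ w₃ hz, w₁ z hz, w₂ z hz, w₃ z hz] at h1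
  refine (mul_eq_zero.1 (?_ : s₁ * s₂ * s₃ * _ = 0)).resolve_left
    (mul_ne_zero (mul_ne_zero hs₁ hs₂) hs₃)
  rw [← h1]
  ring

/-! ### Extension to the Zariski closure of the conjugate curve -/

/-- The function `∑ ε_i a_i(z) y_i`, polarization of `∑ ε_i |a_i|²`. -/
noncomputable def hermPol {ι : Type*} [Fintype ι] (a : ι → ℂ → ℂ) (ε y : ι → ℂ) (z : ℂ) : ℂ :=
  ∑ i, ε i * y i * a i z

section

open MvPolynomial

variable {U : Set ℂ} {ι : Type*}

theorem differentiableOn_aeval {β : ι → ℂ → ℂ} (hβ : ∀ i, DifferentiableOn ℂ (β i) U)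
    (p : MvPolynomial ι ℂ) : DifferentiableOn ℂ (fun w => aeval (fun i => β i w) p) U := by
  induction p using MvPolynomial.induction_on with
  | C c => simp
  | add p q hp hq => simp only [map_add]; exact hp.add hq
  | mul_X p i hp => simp only [map_mul, aeval_X]; exact hp.mul (hβ i)

/-- Pulling polynomials back along `β` lands in holomorphic functions on a connected open set, where
a product vanishes only if a factor does. -/
theorem isPrime_vanishingIdeal_image (hU : IsOpen U) (hc : IsPreconnected U) (hne : U.Nonempty)
    {β : ι → ℂ → ℂ} (hβ : ∀ i, DifferentiableOn ℂ (β i) U) :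
    (vanishingIdeal ℂ ((fun w i => β i w) '' U)).IsPrime := by
  refine ⟨fun h => ?_, fun {p q} hpq => ?_⟩
  · obtain ⟨w, hw⟩ := hne
    have h1 := (Ideal.eq_top_iff_one _).1 h _ (Set.mem_image_of_mem _ hw)
    simp at h1
  · have h1 := AnalyticOnNhd.eq_zero_or_eq_zero_of_mul_eq_zero
      ((differentiableOn_aeval hβ p).analyticOnNhd hU) ((differentiableOn_aeval hβ q).analyticOnNhd hU)
      (fun w hw => by
        have := hpq _ (Set.mem_image_of_mem _ hw)
        rwa [map_mul] at this) hc
    refine h1.imp (fun h => ?_) fun h => ?_ <;>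
    · rintro _ ⟨w, hw, rfl⟩
      exact h w hw

variable [Fintype ι]

theorem differentiableOn_hermPol {a : ι → ℂ → ℂ} (ha : ∀ i, DifferentiableOn ℂ (a i) U)
    (ε y : ι → ℂ) : DifferentiableOn ℂ (hermPol a ε y) U :=
  differentiableOn_sum_mul ha _

/-- The linear form `∑ ε_i a_i X_i`. -/
noncomputable def linForm (ε a : ι → ℂ) : MvPolynomial ι ℂ := ∑ i, C (ε i * a i) * X i

theorem aeval_linForm_hermPol (a : ι → ℂ → ℂ) (ε y : ι → ℂ) (z : ℂ) :
    aeval y (linForm ε fun i => a i z) = hermPol a ε y z := by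
  simp only [linForm, hermPol, map_sum, map_mul, aeval_C, aeval_X, Algebra.algebraMap_self,
    RingHom.id_apply]
  exact Finset.sum_congr rfl fun i _ => by ring

theorem aeval_linForm_deriv (hU : IsOpen U) {a : ι → ℂ → ℂ}
    (ha : ∀ i, DifferentiableOn ℂ (a i) U) (ε y : ι → ℂ) {z : ℂ} (hz : z ∈ U) :
    aeval y (linForm ε fun i => deriv (a i) z) = deriv (hermPol a ε y) z := by
  rw [aeval_linForm_hermPol (fun i => deriv (a i))]
  exact (deriv_sum_mul hU ha _ hz).symm

/-- If `∂_z (B/C)` is a combination of logarithmic derivatives of finite rank functions of `(z, w)`,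
then it does not depend on `w`. -/
theorem exists_deriv_eq_const_mul (hU : IsOpen U) (hc : IsPreconnected U) (μ : ℂ)
    {a β : ι → ℂ → ℂ} (ha : ∀ i, DifferentiableOn ℂ (a i) U)
    (hβ : ∀ i, DifferentiableOn ℂ (β i) U) {B C D N f : ι → ℂ} {z₀ w₀ : ℂ} (hz₀ : z₀ ∈ U)
    (hw₀ : w₀ ∈ U) (hC0 : hermPol a C (fun i => β i w₀) z₀ ≠ 0)
    (hD0 : hermPol a D (fun i => β i w₀) z₀ ≠ 0) (hN0 : hermPol a N (fun i => β i w₀) z₀ ≠ 0)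
    (hf0 : hermPol a f (fun i => β i w₀) z₀ ≠ 0)
    (hI : ∀ z ∈ U, ∀ w ∈ U, let y := fun i => β i w
      (deriv (hermPol a B y) z * hermPol a C y z - hermPol a B y z * deriv (hermPol a C y) z) *
        (hermPol a D y z * hermPol a N y z * hermPol a f y z) +
        hermPol a C y z ^ 2 * logNum μ (hermPol a D y) (hermPol a N y) (hermPol a f y) z = 0)
    {z : ℂ} (hz : z ∈ U) (hCz : ∃ w ∈ U, hermPol a C (fun i => β i w) z ≠ 0) :
    ∃ c : ℂ, ∀ w ∈ U, let y := fun i => β i w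
      deriv (hermPol a B y) z * hermPol a C y z - hermPol a B y z * deriv (hermPol a C y) z =
        c * hermPol a C y z ^ 2 := by
  set P : Ideal (MvPolynomial ι ℂ) := vanishingIdeal ℂ ((fun w i => β i w) '' U) with hP
  have hprime : P.IsPrime := isPrime_vanishingIdeal_image hU hc ⟨z, hz⟩ hβ
  -- For fixed `z` the identity is a polynomial in `y`; vanishing on `β(U)`, it lies in `P`.
  have hIy : ∀ y ∈ zeroLocus ℂ P, ∀ z ∈ U,
      (deriv (hermPol a B y) z * hermPol a C y z - hermPol a B y z * deriv (hermPol a C y) z) *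
        (hermPol a D y z * hermPol a N y z * hermPol a f y z) +
        hermPol a C y z ^ 2 * logNum μ (hermPol a D y) (hermPol a N y) (hermPol a f y) z = 0 := by
    intro y hy z hz
    let L : (ι → ℂ) → MvPolynomial ι ℂ := fun ε => linForm ε fun i => a i z
    let L' : (ι → ℂ) → MvPolynomial ι ℂ := fun ε => linForm ε fun i => deriv (a i) z
    have hL : ∀ y ε, aeval y (L ε) = hermPol a ε y z := fun y ε => aeval_linForm_hermPol a ε y z
    have hL' : ∀ y ε, aeval y (L' ε) = deriv (hermPol a ε y) z :=
      fun y ε => aeval_linForm_deriv hU ha ε y hz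
    have key : ∀ y, aeval y ((L' B * L C - L B * L' C) * (L D * L N * L f) + L C ^ 2 *
        (L' D * L f * L N - MvPolynomial.C μ * L' f * L D * L N - L' N * L D * L f)) =
      (deriv (hermPol a B y) z * hermPol a C y z - hermPol a B y z * deriv (hermPol a C y) z) *
        (hermPol a D y z * hermPol a N y z * hermPol a f y z) +
        hermPol a C y z ^ 2 * logNum μ (hermPol a D y) (hermPol a N y) (hermPol a f y) z := by
      intro y
      simp only [map_add, map_mul, map_sub, map_pow, hL, hL', aeval_C, Algebra.algebraMap_self,
        RingHom.id_apply]
      rfl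
    rw [← key]
    refine hy _ ?_
    rintro _ ⟨w, hw, rfl⟩
    rw [key]
    exact hI z hz w hw
  obtain ⟨M, hM⟩ := exists_bound_of_logDeriv hU hc μ
    (a₁ := fun i z => D i * a i z) (a₂ := fun i z => N i * a i z) (a₃ := fun i z => f i * a i z)
    (fun i => (ha i).const_mul _) (fun i => (ha i).const_mul _) (fun i => (ha i).const_mul _) hz
  have hsum : ∀ (ε y : ι → ℂ) z, ∑ i, y i * (ε i * a i z) = hermPol a ε y z := fun ε y z =>
    Finset.sum_congr rfl fun i _ => by ring
  simp only [hsum] at hM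
  let L : (ι → ℂ) → MvPolynomial ι ℂ := fun ε => linForm ε fun i => a i z
  let L' : (ι → ℂ) → MvPolynomial ι ℂ := fun ε => linForm ε fun i => deriv (a i) z
  let L₀ : (ι → ℂ) → MvPolynomial ι ℂ := fun ε => linForm ε fun i => a i z₀
  have hL : ∀ y ε, aeval y (L ε) = hermPol a ε y z := fun y ε => aeval_linForm_hermPol a ε y z
  have hL₀ : ∀ y ε, aeval y (L₀ ε) = hermPol a ε y z₀ := fun y ε => aeval_linForm_hermPol a ε y z₀
  have hL' : ∀ y ε, aeval y (L' ε) = deriv (hermPol a ε y) z :=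
    fun y ε => aeval_linForm_deriv hU ha ε y hz
  have hq : L C ^ 2 ∉ P := by
    intro h
    obtain ⟨w, hw, hne⟩ := hCz
    have h1 := h _ (Set.mem_image_of_mem _ hw)
    rw [map_pow, hL] at h1
    exact hne (pow_eq_zero_iff two_ne_zero |>.1 h1)
  -- Where this product is nonzero at `y`, the functions of `z` attached to `C`, `D`, `N`, `f` do
  -- not vanish at `z₀`, so none is identically zero.
  have he : L₀ C * L₀ D * L₀ N * L₀ f ∉ P := by
    intro h
    have h1 := h _ (Set.mem_image_of_mem _ hw₀)
    simp only [map_mul, hL₀] at h1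
    exact mul_ne_zero (mul_ne_zero (mul_ne_zero hC0 hD0) hN0) hf0 h1
  obtain ⟨c, hcP⟩ := exists_sub_C_mul_mem_of_bounded (p := L' B * L C - L B * L' C) hq he M (by
    intro y hy hey
    simp only [map_mul, hL₀] at hey
    have hCy := left_ne_zero_of_mul (left_ne_zero_of_mul (left_ne_zero_of_mul hey))
    have hDy := right_ne_zero_of_mul (left_ne_zero_of_mul (left_ne_zero_of_mul hey))
    have hNy := right_ne_zero_of_mul (left_ne_zero_of_mul hey)
    have hfy := right_ne_zero_of_mul hey
    have dP := fun ε => differentiableOn_hermPol ha ε y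
    obtain ⟨k, hk, hkC⟩ := exists_differentiableOn_eq_mul hU hc (dP B) (dP C) (dP D) (dP N) (dP f)
      ⟨z₀, hz₀, hCy⟩ ⟨z₀, hz₀, hDy⟩ ⟨z₀, hz₀, hNy⟩ ⟨z₀, hz₀, hfy⟩ (hIy y hy)
    have hder : ∀ z ∈ U, deriv (hermPol a B y) z * hermPol a C y z -
        hermPol a B y z * deriv (hermPol a C y) z = deriv k z * hermPol a C y z ^ 2 := by
      intro z hz
      have h1 : hermPol a B y =ᶠ[𝓝 z] fun z => k z * hermPol a C y z := by
        filter_upwards [hU.mem_nhds hz] with x hx using hkC x hx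
      rw [h1.deriv_eq, deriv_fun_mul (hk.differentiableAt (hU.mem_nhds hz))
        ((dP C).differentiableAt (hU.mem_nhds hz)), hkC z hz]
      ring
    have hlog : DifferentiableOn ℂ (logNum μ (hermPol a D y) (hermPol a N y) (hermPol a f y)) U :=
      (((((dP D).deriv hU).mul (dP f)).mul (dP N)).sub
        (((((dP f).deriv hU).const_mul μ).mul (dP D)).mul (dP N))).sub
        ((((dP N).deriv hU).mul (dP D)).mul (dP f))
    have hF := (((dP D).mul (dP N)).mul (dP f))
    -- With `B = k C`, the identity has the factor `C ^ 2`; cancelling it leaves the relation for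
    -- `deriv k` to which the uniform bound applies.
    have h2 := eqOn_of_mul_eq_mul hU hc (((hk.deriv hU).mul hF).add hlog) (differentiableOn_const 0)
      ((dP C).pow 2) ⟨z₀, hz₀, pow_ne_zero 2 hCy⟩ (fun z hz => by
        have h3 := hIy y hy z hz
        rw [hder z hz] at h3
        simp only [Pi.add_apply, Pi.mul_apply, Pi.pow_apply]
        linear_combination h3)
    have h4 := hM y y y ⟨z₀, hz₀, hDy⟩ ⟨z₀, hz₀, hNy⟩ ⟨z₀, hz₀, hfy⟩ (deriv k) (hk.deriv hU) h2
    simp only [map_sub, map_mul, map_pow, hL, hL', hder z hz]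
    rw [norm_mul]
    exact mul_le_mul_of_nonneg_right h4 (norm_nonneg _))
  refine ⟨c, fun w hw => ?_⟩
  have h1 := hcP _ (Set.mem_image_of_mem _ hw)
  simp only [map_sub, map_mul, map_pow, hL, hL', aeval_C, Algebra.algebraMap_self,
        RingHom.id_apply] at h1
  exact sub_eq_zero.1 h1

end

/-! ### Polarization in two complex variables -/

/-- `K` is holomorphic along all holomorphic curves in `U × U`. -/
def HolAlongCurves (U : Set ℂ) (K : ℂ → ℂ → ℂ) : Prop :=
  ∀ (V : Set ℂ) (u v : ℂ → ℂ), IsOpen V → DifferentiableOn ℂ u V → DifferentiableOn ℂ v V →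
    Set.MapsTo u V U → Set.MapsTo v V U → DifferentiableOn ℂ (fun x => K (u x) (v x)) V

namespace HolAlongCurves

variable {U : Set ℂ} {K L : ℂ → ℂ → ℂ}

theorem fst {f : ℂ → ℂ} (hf : DifferentiableOn ℂ f U) : HolAlongCurves U fun s _ => f s :=
  fun _ _ _ _ hu _ mu _ => hf.comp hu mu

theorem add (hK : HolAlongCurves U K) (hL : HolAlongCurves U L) :
    HolAlongCurves U fun s t => K s t + L s t :=
  fun V u v hV hu hv mu mv => (hK V u v hV hu hv mu mv).add (hL V u v hV hu hv mu mv)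

theorem sub (hK : HolAlongCurves U K) (hL : HolAlongCurves U L) :
    HolAlongCurves U fun s t => K s t - L s t :=
  fun V u v hV hu hv mu mv => (hK V u v hV hu hv mu mv).sub (hL V u v hV hu hv mu mv)

theorem mul (hK : HolAlongCurves U K) (hL : HolAlongCurves U L) :
    HolAlongCurves U fun s t => K s t * L s t :=
  fun V u v hV hu hv mu mv => (hK V u v hV hu hv mu mv).mul (hL V u v hV hu hv mu mv)

theorem congr (hK : HolAlongCurves U K) (h : ∀ s ∈ U, ∀ t ∈ U, L s t = K s t) :
    HolAlongCurves U L :=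
  fun V u v hV hu hv mu mv => (hK V u v hV hu hv mu mv).congr fun _ hx => h _ (mu hx) _ (mv hx)

theorem fst_apply (hK : HolAlongCurves U K) (hU : IsOpen U) {t : ℂ} (ht : t ∈ U) :
    DifferentiableOn ℂ (fun s => K s t) U :=
  hK U id (fun _ => t) hU differentiableOn_id (differentiableOn_const t) (Set.mapsTo_id U)
    fun _ _ => ht

theorem snd_apply (hK : HolAlongCurves U K) (hU : IsOpen U) {s : ℂ} (hs : s ∈ U) :
    DifferentiableOn ℂ (fun t => K s t) U :=
  hK U (fun _ => s) id hU (differentiableOn_const s) differentiableOn_id (fun _ _ => hs)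
    (Set.mapsTo_id U)

theorem hermPol {ι : Type*} [Fintype ι] {a b : ι → ℂ → ℂ} (ha : ∀ i, DifferentiableOn ℂ (a i) U)
    (hb : ∀ i, DifferentiableOn ℂ (b i) U) (ε : ι → ℂ) :
    HolAlongCurves U fun s t => hermPol a ε (fun i => b i t) s := fun _ _ _ _ hu hv mu mv =>
  DifferentiableOn.fun_sum fun i _ =>
    (((hb i).comp hv mv).const_mul _).mul ((ha i).comp hu mu)

theorem deriv_hermPol (hU : IsOpen U) {ι : Type*} [Fintype ι] {a b : ι → ℂ → ℂ}
    (ha : ∀ i, DifferentiableOn ℂ (a i) U) (hb : ∀ i, DifferentiableOn ℂ (b i) U) (ε : ι → ℂ) :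
    HolAlongCurves U fun s t => deriv (Umehara.hermPol a ε (fun i => b i t)) s :=
  (hermPol (fun i => (ha i).deriv hU) hb ε).congr fun _ hs _ _ => deriv_sum_mul hU ha _ hs

end HolAlongCurves

/-- Real points of `V` accumulate at `0`, so the identity theorem applies. -/
theorem eqOn_zero_of_forall_real {V : Set ℂ} (hV : IsOpen V) (hc : IsPreconnected V)
    (h0 : (0 : ℂ) ∈ V) {F : ℂ → ℂ} (hF : DifferentiableOn ℂ F V)
    (h : ∀ x : ℝ, (x : ℂ) ∈ V → F x = 0) : ∀ x ∈ V, F x = 0 := by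
  have ht : Tendsto (fun x : ℝ => (x : ℂ)) (𝓝[≠] 0) (𝓝[≠] 0) := by
    refine tendsto_nhdsWithin_iff.2 ⟨?_, ?_⟩
    · exact (Complex.continuous_ofReal.tendsto' 0 0 Complex.ofReal_zero).mono_left nhdsWithin_le_nhds
    · filter_upwards [self_mem_nhdsWithin] with x hx
      exact Complex.ofReal_ne_zero.2 hx
  have he : ∀ᶠ x : ℝ in 𝓝[≠] 0, F x = 0 := by
    filter_upwards [ht (nhdsWithin_le_nhds (hV.mem_nhds h0))] with x hx using h x hx
  exact (hF.analyticOnNhd hV).eqOn_zero_of_preconnected_of_frequently_eq_zero hc h0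
    (ht.frequently he.frequently)

/-- A holomorphic function `K(s, t)` which vanishes for `t = conj s` is zero. -/
theorem eq_zero_of_forall_conj {R : ℝ} {K : ℂ → ℂ → ℂ} (hK : HolAlongCurves (Metric.ball 0 R) K)
    (h : ∀ s ∈ Metric.ball (0 : ℂ) R, K s (starRingEnd ℂ s) = 0) :
    ∀ s ∈ Metric.ball (0 : ℂ) R, ∀ t ∈ Metric.ball (0 : ℂ) R, K s t = 0 := by
  let I := Complex.I
  have hV : ∀ u v : ℂ → ℂ, Continuous u → Continuous v →
      IsOpen (u ⁻¹' Metric.ball 0 R ∩ v ⁻¹' Metric.ball 0 R) := fun u v hu hv =>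
    (Metric.isOpen_ball.preimage hu).inter (Metric.isOpen_ball.preimage hv)
  have hcv : ∀ c d e f : ℂ, IsPreconnected ((fun x : ℂ => c + d * x) ⁻¹' Metric.ball 0 R ∩
      (fun x : ℂ => e + f * x) ⁻¹' Metric.ball 0 R) := by
    have h1 : ∀ c d : ℂ, Convex ℝ ((fun x : ℂ => c + d * x) ⁻¹' Metric.ball 0 R) := by
      intro c d
      have := ((convex_ball (0 : ℂ) R).translate_preimage_right c).linear_preimage
        (LinearMap.mulLeft ℝ d)
      exact this
    exact fun c d e f => ((h1 c d).inter (h1 e f)).isPreconnected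
  -- In the coordinates `s = x + I y`, `t = x - I y`, the condition `t = conj s` means that `x` and
  -- `y` are real. Here `x` is made complex with `y` real; afterwards `y` is made complex.
  have step : ∀ y : ℝ, (y : ℂ) ∈ Metric.ball (0 : ℂ) R → ∀ x : ℂ,
      x + I * y ∈ Metric.ball (0 : ℂ) R → x - I * y ∈ Metric.ball (0 : ℂ) R →
      K (x + I * y) (x - I * y) = 0 := by
    intro y hy x h1 h2
    have hyI : I * y ∈ Metric.ball (0 : ℂ) R := by
      rw [mem_ball_zero_iff] at hy ⊢
      rwa [norm_mul, Complex.norm_I, one_mul]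
    have hyI' : -(I * y) ∈ Metric.ball (0 : ℂ) R := by
      rw [mem_ball_zero_iff] at hyI ⊢
      rwa [norm_neg]
    have key := eqOn_zero_of_forall_real (V := (fun x : ℂ => I * y + 1 * x) ⁻¹' Metric.ball 0 R ∩
      (fun x : ℂ => -(I * y) + 1 * x) ⁻¹' Metric.ball 0 R)
      (F := fun x => K (I * y + 1 * x) (-(I * y) + 1 * x))
      (hV _ _ (by fun_prop) (by fun_prop)) (hcv _ _ _ _)
      ⟨by simpa only [Set.mem_preimage, mul_zero, add_zero] using hyI,
        by simpa only [Set.mem_preimage, mul_zero, add_zero] using hyI'⟩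
      (hK _ _ _ (hV _ _ (by fun_prop) (by fun_prop)) (by fun_prop) (by fun_prop)
        Set.inter_subset_left Set.inter_subset_right) (fun x hx => by
          have := h _ hx.1
          rw [map_add, map_mul, map_mul, Complex.conj_ofReal, Complex.conj_ofReal, Complex.conj_I,
            map_one, neg_mul] at this
          exact this) x
    have e1 : I * y + 1 * x = x + I * y := by ring
    have e2 : -(I * y) + 1 * x = x - I * y := by ring
    simp only [Set.mem_inter_iff, Set.mem_preimage, e1, e2] at key
    exact key ⟨h1, h2⟩
  intro s hs t ht
  rw [mem_ball_zero_iff] at hs ht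
  have hx : ‖(s + t) / 2‖ < R := by
    rw [norm_div, Complex.norm_two]
    have := norm_add_le s t
    linarith
  have key := eqOn_zero_of_forall_real
    (V := (fun y : ℂ => (s + t) / 2 + I * y) ⁻¹' Metric.ball 0 R ∩
      (fun y : ℂ => (s + t) / 2 + -I * y) ⁻¹' Metric.ball 0 R)
    (F := fun y => K ((s + t) / 2 + I * y) ((s + t) / 2 + -I * y))
    (hV _ _ (by fun_prop) (by fun_prop)) (hcv _ _ _ _)
    ⟨by simpa using hx, by simpa using hx⟩
    (hK _ _ _ (hV _ _ (by fun_prop) (by fun_prop)) (by fun_prop) (by fun_prop)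
      Set.inter_subset_left Set.inter_subset_right) (fun y hy => by
        have h1 := hy.1
        have h2 := hy.2
        have e2 : (s + t) / 2 + -I * y = (s + t) / 2 - I * y := by ring
        simp only [Set.mem_preimage, e2] at h1 h2 ⊢
        refine step y ?_ _ h1 h2
        rw [mem_ball_zero_iff] at h1 h2 ⊢
        -- Half the difference of two points of the disc stays in the disc, so `‖y‖ < R` as `step`
        -- requires.
        have h3 : ‖(2 : ℂ) * (I * y)‖ ≤ ‖(s + t) / 2 + I * y‖ + ‖(s + t) / 2 - I * y‖ := by
          refine le_trans (le_of_eq ?_) (norm_sub_le _ _)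
          congr 1; ring
        rw [norm_mul, norm_mul, Complex.norm_I, Complex.norm_two] at h3
        linarith) (-I * ((s - t) / 2))
  have e1 : (s + t) / 2 + I * (-I * ((s - t) / 2)) = s := by
    linear_combination (-(s - t) / 2) * Complex.I_mul_I
  have e2 : (s + t) / 2 + -I * (-I * ((s - t) / 2)) = t := by
    linear_combination ((s - t) / 2) * Complex.I_mul_I
  simp only [Set.mem_inter_iff, Set.mem_preimage, e1, e2, mem_ball_zero_iff] at key
  exact key ⟨hs, ht⟩

/-- Near a given point both curves stay in a disc of radius `ρ < R`, where the series is dominated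
by its value of absolute terms at `ρ`. -/
theorem holAlongCurves_tsum {Q : Type*} {R : ℝ} {c : Q → ℂ} {m n : Q → ℕ}
    (h : ∀ ρ : ℝ, 0 ≤ ρ → ρ < R → Summable fun q => ‖c q‖ * ρ ^ m q * ρ ^ n q) :
    HolAlongCurves (Metric.ball 0 R) fun s t => ∑' q, c q * s ^ m q * t ^ n q := by
  intro V u v hV hu hv mu mv x hx
  obtain ⟨ρ, h1, h2⟩ := exists_between (max_lt (mem_ball_zero_iff.1 (mu hx))
    (mem_ball_zero_iff.1 (mv hx)))
  have hρ : 0 ≤ ρ := (norm_nonneg _).trans ((le_max_left _ _).trans h1.le)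
  let V' : Set ℂ := (V ∩ u ⁻¹' Metric.ball 0 ρ) ∩ (V ∩ v ⁻¹' Metric.ball 0 ρ)
  have hV' : IsOpen V' := (hu.continuousOn.isOpen_inter_preimage hV Metric.isOpen_ball).inter
    (hv.continuousOn.isOpen_inter_preimage hV Metric.isOpen_ball)
  have hxV : x ∈ V' := ⟨⟨hx, mem_ball_zero_iff.2 ((le_max_left _ _).trans_lt h1)⟩,
    ⟨hx, mem_ball_zero_iff.2 ((le_max_right _ _).trans_lt h1)⟩⟩
  have hd := Complex.differentiableOn_tsum_of_summable_norm (U := V')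
    (F := fun q x => c q * u x ^ m q * v x ^ n q) (h ρ hρ h2)
    (fun q => (((hu.mono fun _ hy => hy.1.1).pow _).const_mul _).mul
      ((hv.mono fun _ hy => hy.1.1).pow _)) hV' (fun q w hw => by
      rw [norm_mul, norm_mul, norm_pow, norm_pow]
      have h3 := (mem_ball_zero_iff.1 hw.1.2).le
      have h4 := (mem_ball_zero_iff.1 hw.2.2).le
      gcongr)
  exact (hd.differentiableAt (hV'.mem_nhds hxV)).differentiableWithinAt

/-! ### Rigidity on a disc -/

/-- The rigidity statement on a disc, in polarized form: here `H = B / C`, and the identity is the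
logarithmic derivative of `e ^ (B / C) = f ^ μ * N / D`. -/
theorem eq_of_deriv_identity {ι : Type*} [Fintype ι] {R : ℝ} (μ : ℂ) {a : ι → ℂ → ℂ}
    (ha : ∀ i, DifferentiableOn ℂ (a i) (Metric.ball 0 R)) {B C D N f : ι → ℂ} {s₀ : ℂ}
    (hs₀ : s₀ ∈ Metric.ball (0 : ℂ) R)
    (hC0 : hermPol a C (fun i => starRingEnd ℂ (a i s₀)) s₀ ≠ 0)
    (hD0 : hermPol a D (fun i => starRingEnd ℂ (a i s₀)) s₀ ≠ 0)
    (hN0 : hermPol a N (fun i => starRingEnd ℂ (a i s₀)) s₀ ≠ 0)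
    (hf0 : hermPol a f (fun i => starRingEnd ℂ (a i s₀)) s₀ ≠ 0)
    (hI : ∀ s ∈ Metric.ball (0 : ℂ) R, let y := fun i => starRingEnd ℂ (a i s)
      (deriv (hermPol a B y) s * hermPol a C y s - hermPol a B y s * deriv (hermPol a C y) s) *
        (hermPol a D y s * hermPol a N y s * hermPol a f y s) +
        hermPol a C y s ^ 2 * logNum μ (hermPol a D y) (hermPol a N y) (hermPol a f y) s = 0)
    {H : ℂ → ℂ → ℂ} (hH : HolAlongCurves (Metric.ball 0 R) H)
    (hH₁ : ∀ s, H s 0 = H 0 0) (hH₂ : ∀ t, H 0 t = H 0 0)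
    (hHC : ∀ s ∈ Metric.ball (0 : ℂ) R, hermPol a C (fun i => starRingEnd ℂ (a i s)) s ≠ 0 →
      H s (starRingEnd ℂ s) * hermPol a C (fun i => starRingEnd ℂ (a i s)) s =
        hermPol a B (fun i => starRingEnd ℂ (a i s)) s) :
    ∀ s ∈ Metric.ball (0 : ℂ) R, ∀ t ∈ Metric.ball (0 : ℂ) R, H s t = H 0 0 := by
  set U := Metric.ball (0 : ℂ) R with hUdef
  have hU : IsOpen U := Metric.isOpen_ball
  have hc : IsPreconnected U := (convex_ball _ _).isPreconnected
  have h0 : (0 : ℂ) ∈ U := by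
    rw [hUdef, mem_ball_zero_iff] at hs₀ ⊢
    rw [norm_zero]
    exact (norm_nonneg _).trans_lt hs₀
  have hconj : ∀ s ∈ U, starRingEnd ℂ s ∈ U := fun s hs => by
    rw [hUdef, mem_ball_zero_iff] at hs ⊢
    rwa [RCLike.norm_conj]
  set β : ι → ℂ → ℂ := fun i t => starRingEnd ℂ (a i (starRingEnd ℂ t)) with hβdef
  have hβ : ∀ i, DifferentiableOn ℂ (β i) U := fun i t ht =>
    (differentiableAt_conj_conj_iff.2 ((ha i).differentiableAt
      (hU.mem_nhds (hconj t ht)))).differentiableWithinAt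
  have hβc : ∀ s, (fun i => β i (starRingEnd ℂ s)) = fun i => starRingEnd ℂ (a i s) := fun s => by
    simp only [hβdef, Complex.conj_conj]
  have hp := HolAlongCurves.hermPol ha hβ
  have hd := HolAlongCurves.deriv_hermPol hU ha hβ
  have hIst : ∀ z ∈ U, ∀ w ∈ U, let y := fun i => β i w
      (deriv (hermPol a B y) z * hermPol a C y z - hermPol a B y z * deriv (hermPol a C y) z) *
        (hermPol a D y z * hermPol a N y z * hermPol a f y z) +
        hermPol a C y z ^ 2 * logNum μ (hermPol a D y) (hermPol a N y) (hermPol a f y) z = 0 := by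
    intro s hs t ht
    have hμ : HolAlongCurves U fun _ _ => μ := HolAlongCurves.fst (differentiableOn_const μ)
    have hlog : HolAlongCurves U fun s t => logNum μ (hermPol a D fun i => β i t)
        (hermPol a N fun i => β i t) (hermPol a f fun i => β i t) s :=
      ((((hd D).mul (hp f)).mul (hp N)).sub (((hμ.mul (hd f)).mul (hp D)).mul (hp N))).sub
        (((hd N).mul (hp D)).mul (hp f))
    have hC2 : HolAlongCurves U fun s t => hermPol a C (fun i => β i t) s ^ 2 :=
      ((hp C).mul (hp C)).congr fun _ _ _ _ => sq _
    refine eq_zero_of_forall_conj (((((hd B).mul (hp C)).sub ((hp B).mul (hd C))).mul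
      (((hp D).mul (hp N)).mul (hp f))).add (hC2.mul hlog)) (fun s hs => ?_) s hs t ht
    simp only [hβc]
    exact hI s hs
  set w₀ := starRingEnd ℂ s₀ with hw₀
  have hw₀U : w₀ ∈ U := hconj s₀ hs₀
  rw [← hβc] at hC0 hD0 hN0 hf0
  -- Since `H = B / C` is known only where `C ≠ 0`, the relation is first polarized with an extra
  -- factor `C`. That factor is cancelled in `z` for each `w` with `C(s₀, w) ≠ 0`, and the remaining
  -- `w` follow by continuation in `w`.
  have hB : ∀ s ∈ U, ∀ t ∈ U, H s t * hermPol a C (fun i => β i t) s =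
      hermPol a B (fun i => β i t) s := by
    have h1 : ∀ s ∈ U, ∀ t ∈ U, hermPol a C (fun i => β i t) s *
        (H s t * hermPol a C (fun i => β i t) s - hermPol a B (fun i => β i t) s) = 0 := by
      refine eq_zero_of_forall_conj ((hp C).mul ((hH.mul (hp C)).sub (hp B))) fun s hs => ?_
      rw [hβc]
      by_cases hCs : hermPol a C (fun i => starRingEnd ℂ (a i s)) s = 0
      · rw [hCs, zero_mul]
      · rw [hHC s hs hCs, sub_self, mul_zero]
    intro s hs t ht
    refine eqOn_of_mul_eq_mul hU hc ((hH.mul (hp C)).snd_apply hU hs) ((hp B).snd_apply hU hs)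
      ((hp C).snd_apply hU hs₀) ⟨w₀, hw₀U, hC0⟩ (fun w hw => ?_) t ht
    by_cases hCw : hermPol a C (fun i => β i w) s₀ = 0
    · simp only [hCw, zero_mul]
    · congr 1
      refine eqOn_of_mul_eq_mul hU hc ((hH.mul (hp C)).fst_apply hU hw) ((hp B).fst_apply hU hw)
        ((hp C).fst_apply hU hw) ⟨s₀, hs₀, hCw⟩ (fun z hz => ?_) s hs
      have := h1 z hz w hw
      rw [mul_sub] at this
      exact sub_eq_zero.1 this
  have hmain : ∀ w₁ ∈ U, ∀ w₂ ∈ U, hermPol a C (fun i => β i w₁) s₀ ≠ 0 →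
      hermPol a C (fun i => β i w₂) s₀ ≠ 0 → ∀ z ∈ U, H z w₁ = H z w₂ := by
    intro w₁ hw₁ w₂ hw₂ h₁ h₂ z hz
    have hder : ∀ w ∈ U, ∀ z ∈ U, deriv (hermPol a B fun i => β i w) z *
        hermPol a C (fun i => β i w) z - hermPol a B (fun i => β i w) z *
          deriv (hermPol a C fun i => β i w) z =
        deriv (fun z => H z w) z * hermPol a C (fun i => β i w) z ^ 2 := by
      intro w hw z hz
      have h1 : (hermPol a B fun i => β i w) =ᶠ[𝓝 z] fun z => H z w * hermPol a C (fun i => β i w) z := by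
        filter_upwards [hU.mem_nhds hz] with x hx using (hB x hx w hw).symm
      rw [h1.deriv_eq, deriv_fun_mul ((hH.fst_apply hU hw).differentiableAt (hU.mem_nhds hz))
        (((hp C).fst_apply hU hw).differentiableAt (hU.mem_nhds hz)), ← hB z hz w hw]
      ring
    have d₁ := hH.fst_apply hU hw₁
    have d₂ := hH.fst_apply hU hw₂
    have hdz : ∀ z ∈ U, deriv (fun z => H z w₁ - H z w₂) z = 0 := by
      refine eqOn_of_mul_eq_mul hU hc ((d₁.sub d₂).deriv hU) (differentiableOn_const 0)
        (((hp C).fst_apply hU hw₁).mul ((hp C).fst_apply hU hw₂)) ⟨s₀, hs₀, mul_ne_zero h₁ h₂⟩ ?_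
      intro z hz
      by_cases hz0 : hermPol a C (fun i => β i w₁) z * hermPol a C (fun i => β i w₂) z = 0
      · simp only [Pi.mul_apply, hz0, zero_mul]
      obtain ⟨c, hcw⟩ := exists_deriv_eq_const_mul hU hc μ ha hβ hs₀ hw₀U hC0 hD0 hN0 hf0 hIst hz
        ⟨w₁, hw₁, left_ne_zero_of_mul hz0⟩
      have hval : ∀ w ∈ U, hermPol a C (fun i => β i w) z ≠ 0 → deriv (fun z => H z w) z = c := by
        intro w hw hne
        have h1 := hcw w hw
        simp only [hder w hw z hz] at h1
        exact mul_right_cancel₀ (pow_ne_zero 2 hne) h1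
      congr 1
      rw [deriv_fun_sub (d₁.differentiableAt (hU.mem_nhds hz)) (d₂.differentiableAt (hU.mem_nhds hz)),
        hval w₁ hw₁ (left_ne_zero_of_mul hz0), hval w₂ hw₂ (right_ne_zero_of_mul hz0), sub_self]
    -- The difference is constant in `z`, and its value at `z = 0` is zero by the diastasis
    -- condition `hH₂`.
    have h3 := hU.is_const_of_deriv_eq_zero hc (d₁.sub d₂) hdz hz h0
    simp only [Pi.sub_apply, hH₂, sub_self] at h3
    exact sub_eq_zero.1 h3
  intro s hs t ht
  have h1 : ∀ w ∈ U, H s w = H s w₀ := by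
    refine eqOn_of_mul_eq_mul hU hc (hH.snd_apply hU hs) (differentiableOn_const _)
      ((hp C).snd_apply hU hs₀) ⟨w₀, hw₀U, hC0⟩ fun w hw => ?_
    by_cases hw0 : hermPol a C (fun i => β i w) s₀ = 0
    · simp only [hw0, zero_mul]
    · rw [hmain w hw w₀ hw₀U hw0 hC0 s hs]
  rw [h1 t ht, ← h1 0 h0, hH₁]

/-! ### The differentiated identity and rigidity on a ball -/

theorem deriv_identity_of_exp_eq {B C D N f : ℝ → ℝ} {B' C' D' N' f' μ t : ℝ}
    (hB : HasDerivAt B B' t) (hC : HasDerivAt C C' t) (hD : HasDerivAt D D' t)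
    (hN : HasDerivAt N N' t) (hf : HasDerivAt f f' t) (hC0 : C t ≠ 0) (hD0 : D t ≠ 0)
    (hf0 : 0 < f t) (h : ∀ᶠ x in 𝓝 t, Real.exp (B x / C x) = f x ^ μ * (N x / D x)) :
    (B' * C t - B t * C') * (D t * N t * f t) +
      C t ^ 2 * (D' * f t * N t - μ * f' * D t * N t - N' * D t * f t) = 0 := by
  have h1 := (hB.div hC hC0).exp
  have h2 := ((hf.rpow_const (p := μ) (Or.inl hf0.ne')).mul (hN.div hD hD0)).congr_of_eventuallyEq h
  have h3 := h1.unique h2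
  simp only [Pi.div_apply] at h3
  -- Replacing the exponential by the right-hand side makes `f t ^ μ` a common factor; cancelling it
  -- leaves no real power.
  rw [h.self_of_nhds, Real.rpow_sub_one hf0.ne'] at h3
  have hp : f t ^ μ ≠ 0 := (Real.rpow_pos_of_pos hf0 μ).ne'
  generalize f t ^ μ = P at h3 hp
  have hf0' := hf0.ne'
  field_simp at h3
  linear_combination h3

section

variable {E : Type*} [NormedAddCommGroup E] [NormedSpace ℂ E] {ι : Type*} [Fintype ι]

/-- The real function `∑ ε_i |α_i|²`. -/
noncomputable def hermForm {X : Type*} (α : ι → X → ℂ) (ε : ι → ℝ) (y : X) : ℝ := ∑ i, ε i * ‖α i y‖ ^ 2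

/-- The `(1, 0)`-derivative of `∑ ε_i |α_i|²` in the direction `v`. -/
noncomputable def dHermForm (α : ι → E → ℂ) (ε : ι → ℝ) (v y : E) : ℂ :=
  ∑ i, ε i * starRingEnd ℂ (α i y) * fderiv ℂ (α i) y v

theorem ofReal_hermForm {X : Type*} (α : ι → X → ℂ) (ε : ι → ℝ) (y : X) :
    (hermForm α ε y : ℂ) = ∑ i, ε i * starRingEnd ℂ (α i y) * α i y := by
  simp only [hermForm, Complex.ofReal_sum, Complex.ofReal_mul, Complex.ofReal_pow]
  refine Finset.sum_congr rfl fun i _ => ?_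
  rw [mul_assoc, mul_comm (starRingEnd ℂ _), Complex.mul_conj']

theorem dHermForm_smul (α : ι → E → ℂ) (ε : ι → ℝ) (c : ℂ) (v y : E) :
    dHermForm α ε (c • v) y = c * dHermForm α ε v y := by
  simp only [dHermForm, map_smul, smul_eq_mul, Finset.mul_sum]
  exact Finset.sum_congr rfl fun i _ => by ring

theorem hasDerivAt_hermForm {α : ι → E → ℂ} {y : E} (hα : ∀ i, DifferentiableAt ℂ (α i) y)
    (ε : ι → ℝ) (u : E) :
    HasDerivAt (fun t : ℝ => hermForm α ε (y + (t : ℂ) • u)) (2 * (dHermForm α ε u y).re) 0 := by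
  have hl : HasDerivAt (fun t : ℝ => y + (t : ℂ) • u) u 0 := by
    have h1 : HasDerivAt (fun t : ℝ => (t : ℂ)) 1 0 := Complex.ofRealCLM.hasDerivAt
    simpa using (h1.smul_const u).const_add y
  have h1 : ∀ i, HasDerivAt (fun t : ℝ => ε i * ‖α i (y + (t : ℂ) • u)‖ ^ 2)
      (ε i * (2 * (starRingEnd ℂ (α i y) * fderiv ℂ (α i) y u).re)) 0 := by
    intro i
    have h2 : HasFDerivAt (α i) ((fderiv ℂ (α i) y).restrictScalars ℝ) (y + ((0 : ℝ) : ℂ) • u) := by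
      simpa using (hα i).hasFDerivAt.restrictScalars ℝ
    have h3 := (h2.comp_hasDerivAt (0 : ℝ) hl).norm_sq
    simp only [Complex.ofReal_zero, zero_smul, add_zero, Function.comp_apply, Complex.inner] at h3
    rw [mul_comm (starRingEnd ℂ _)]
    exact h3.const_mul (ε i)
  refine (HasDerivAt.fun_sum fun i _ => h1 i).congr_deriv ?_
  simp only [dHermForm, Complex.re_sum, Finset.mul_sum]
  refine Finset.sum_congr rfl fun i _ => ?_
  rw [mul_assoc, Complex.re_ofReal_mul]
  ring

/-- The logarithmic derivative of `e ^ (B / C) = f ^ μ * N / D`, with denominators cleared. -/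
noncomputable def derivIdentity (μ : ℝ) (α : ι → E → ℂ) (B C D N f : ι → ℝ) (v y : E) : ℂ :=
  (dHermForm α B v y * hermForm α C y - hermForm α B y * dHermForm α C v y) *
    (hermForm α D y * hermForm α N y * hermForm α f y) +
  (hermForm α C y : ℂ) ^ 2 * (dHermForm α D v y * hermForm α f y * hermForm α N y -
    μ * dHermForm α f v y * hermForm α D y * hermForm α N y -
    dHermForm α N v y * hermForm α D y * hermForm α f y)

/-- Real directional derivatives give only the real part. Since the expression is complex linear in
`v`, the direction `I • v` supplies the imaginary part. -/
theorem derivIdentity_eq_zero {μ : ℝ} {α : ι → E → ℂ} {B C D N f : ι → ℝ} {y : E}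
    (hα : ∀ i, DifferentiableAt ℂ (α i) y) (hC0 : hermForm α C y ≠ 0) (hD0 : hermForm α D y ≠ 0)
    (hf0 : 0 < hermForm α f y) (h : ∀ᶠ x in 𝓝 y, Real.exp (hermForm α B x / hermForm α C x) =
      hermForm α f x ^ μ * (hermForm α N x / hermForm α D x)) (v : E) :
    derivIdentity μ α B C D N f v y = 0 := by
  have hre : ∀ u : E, (derivIdentity μ α B C D N f u y).re = 0 := by
    intro u
    have ht : Tendsto (fun t : ℝ => y + (t : ℂ) • u) (𝓝 0) (𝓝 y) := by
      have : Continuous fun t : ℝ => y + (t : ℂ) • u := by fun_prop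
      exact this.tendsto' 0 y (by simp)
    have hd := fun ε => hasDerivAt_hermForm hα ε u
    have key := deriv_identity_of_exp_eq (hd B) (hd C) (hd D) (hd N) (hd f) (by simpa using hC0)
      (by simpa using hD0) (by simpa using hf0) (ht.eventually h)
    simp only [Complex.ofReal_zero, zero_smul, add_zero] at key
    simp only [derivIdentity, Complex.add_re, Complex.sub_re, Complex.mul_re, Complex.mul_im,
      Complex.sub_im, Complex.ofReal_re, Complex.ofReal_im, ← Complex.ofReal_pow]
    linear_combination key / 2
  refine Complex.ext (hre v) ?_
  have h1 := hre (Complex.I • v)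
  have h2 : derivIdentity μ α B C D N f (Complex.I • v) y =
      Complex.I * derivIdentity μ α B C D N f v y := by
    simp only [derivIdentity, dHermForm_smul]
    ring
  rw [h2, Complex.I_mul_re, neg_eq_zero] at h1
  exact h1

theorem analyticAt_ofReal_hermForm {α : ι → E → ℂ} {y : E} (hα : ∀ i, AnalyticAt ℂ (α i) y)
    (ε : ι → ℝ) : AnalyticAt ℝ (fun y => (hermForm α ε y : ℂ)) y := by
  simp only [ofReal_hermForm]
  refine Finset.analyticAt_fun_sum _ fun i _ => (analyticAt_const.mul ?_).mul (hα i).restrictScalars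
  exact (Complex.conjCLE.toContinuousLinearMap.analyticAt _).comp (hα i).restrictScalars

theorem analyticAt_dHermForm {α : ι → E → ℂ} {y : E} (hα : ∀ i, AnalyticAt ℂ (α i) y)
    (ε : ι → ℝ) (v : E) : AnalyticAt ℝ (dHermForm α ε v) y := by
  refine Finset.analyticAt_fun_sum _ fun i _ => (analyticAt_const.mul ?_).mul ?_
  · exact (Complex.conjCLE.toContinuousLinearMap.analyticAt _).comp (hα i).restrictScalars
  · exact (((ContinuousLinearMap.apply ℂ ℂ v).analyticAt _).comp (hα i).fderiv).restrictScalars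

theorem analyticAt_derivIdentity (μ : ℝ) {α : ι → E → ℂ} {y : E} (hα : ∀ i, AnalyticAt ℂ (α i) y)
    (B C D N f : ι → ℝ) (v : E) : AnalyticAt ℝ (derivIdentity μ α B C D N f v) y := by
  have h := analyticAt_ofReal_hermForm hα
  have d := fun ε => analyticAt_dHermForm hα ε v
  exact ((((d B).mul (h C)).sub ((h B).mul (d C))).mul (((h D).mul (h N)).mul (h f))).add
    (((h C).pow 2).mul (((((d D).mul (h f)).mul (h N)).sub
      (((analyticAt_const.mul (d f)).mul (h D)).mul (h N))).sub (((d N).mul (h D)).mul (h f))))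

theorem hermPol_line (α : ι → E → ℂ) (ε : ι → ℝ) (v : E) (s : ℂ) :
    hermPol (fun i s => α i (s • v)) (fun i => ε i) (fun i => starRingEnd ℂ (α i (s • v))) s =
      hermForm α ε (s • v) :=
  (ofReal_hermForm α ε (s • v)).symm

theorem deriv_hermPol_line {α : ι → E → ℂ} {v : E} {s : ℂ}
    (hα : ∀ i, DifferentiableAt ℂ (α i) (s • v)) (ε : ι → ℝ) :
    deriv (hermPol (fun i s => α i (s • v)) (fun i => ε i)
      (fun i => starRingEnd ℂ (α i (s • v)))) s = dHermForm α ε v (s • v) := by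
  have h1 : HasDerivAt (fun s : ℂ => s • v) v s := by
    simpa using (hasDerivAt_id s).smul_const v
  have h2 : ∀ i, HasDerivAt (fun s : ℂ => α i (s • v)) (fderiv ℂ (α i) (s • v) v) s :=
    fun i => (hα i).hasFDerivAt.comp_hasDerivAt s h1
  exact (HasDerivAt.fun_sum fun i _ => (h2 i).const_mul _).deriv

theorem frequently_ne_zero_of_analyticOnNhd {F : E → ℂ} {Ω : Set E}
    (hΩ : IsPreconnected Ω) (hF : AnalyticOnNhd ℝ F Ω) (h0 : ∃ y ∈ Ω, F y ≠ 0) {y : E}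
    (hy : y ∈ Ω) : ∃ᶠ x in 𝓝 y, F x ≠ 0 := by
  obtain ⟨z, hz, hne⟩ := h0
  intro h
  simp only [not_not] at h
  exact hne (hF.eqOn_zero_of_preconnected_of_eventuallyEq_zero hΩ hy h hz)

/-- The rigidity statement on a ball of a complex normed space. -/
theorem eq_of_exp_eq {r μ : ℝ} {α : ι → E → ℂ} (hα : ∀ i, AnalyticOnNhd ℂ (α i) (Metric.ball 0 r))
    {B C D N f : ι → ℝ} {g : E → ℝ}
    (hg : ∀ y ∈ Metric.ball (0 : E) r, hermForm α C y ≠ 0 → g y = hermForm α B y / hermForm α C y)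
    (hexp : ∀ y ∈ Metric.ball (0 : E) r, 0 < hermForm α f y → hermForm α D y ≠ 0 →
      Real.exp (g y) = hermForm α f y ^ μ * (hermForm α N y / hermForm α D y))
    (hC0 : ∃ y ∈ Metric.ball (0 : E) r, hermForm α C y ≠ 0)
    (hD0 : ∃ y ∈ Metric.ball (0 : E) r, hermForm α D y ≠ 0)
    (hf0 : ∃ y ∈ Metric.ball (0 : E) r, 0 < hermForm α f y)
    (hline : ∀ v ∈ Metric.ball (0 : E) r, ∃ R > (1 : ℝ), ∃ H : ℂ → ℂ → ℂ,
      HolAlongCurves (Metric.ball 0 R) H ∧ (∀ s, H s 0 = H 0 0) ∧ (∀ t, H 0 t = H 0 0) ∧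
      ∀ s ∈ Metric.ball (0 : ℂ) R, s • v ∈ Metric.ball (0 : E) r ∧
        H s (starRingEnd ℂ s) = g (s • v)) {y : E} (hy : y ∈ Metric.ball (0 : E) r)
    (hgy : ContinuousAt g y) : g y = g 0 := by
  let _ : NormedSpace ℝ E := NormedSpace.restrictScalars ℝ ℂ E
  set Ω := Metric.ball (0 : E) r
  have hΩ : IsOpen Ω := Metric.isOpen_ball
  have hΩc : IsPreconnected Ω := (convex_ball _ _).isPreconnected
  have hαd : ∀ y ∈ Ω, ∀ i, DifferentiableAt ℂ (α i) y := fun y hy i => (hα i y hy).differentiableAt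
  have han : ∀ ε, AnalyticOnNhd ℝ (fun y => (hermForm α ε y : ℂ)) Ω := fun ε y hy =>
    analyticAt_ofReal_hermForm (fun i => hα i y hy) ε
  have hcont : ∀ ε, ∀ y ∈ Ω, ContinuousAt (hermForm α ε) y := fun ε y hy =>
    Complex.continuous_re.continuousAt.comp (han ε y hy).continuousAt
  have hfreq : ∀ ε, (∃ y ∈ Ω, hermForm α ε y ≠ 0) → ∀ y ∈ Ω, ∃ᶠ x in 𝓝 y, hermForm α ε x ≠ 0 := by
    rintro ε ⟨z, hz, hne⟩ y hy
    refine (frequently_ne_zero_of_analyticOnNhd hΩc (han ε)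
      ⟨z, hz, Complex.ofReal_ne_zero.2 hne⟩ hy).mono fun x hx => Complex.ofReal_ne_zero.1 hx
  obtain ⟨y₀, hy₀, hy₀C, hy₀D, hy₀f⟩ : ∃ y ∈ Ω, hermForm α C y ≠ 0 ∧ hermForm α D y ≠ 0 ∧
      0 < hermForm α f y := by
    obtain ⟨y₁, hy₁, h₁⟩ := hf0
    obtain ⟨y₂, hC₂, hf₂, hy₂⟩ := ((hfreq C hC0 y₁ hy₁).and_eventually
      (((hcont f y₁ hy₁).eventually_const_lt h₁).and (hΩ.eventually_mem hy₁))).exists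
    obtain ⟨y₃, hD₃, hC₃, hf₃, hy₃⟩ := ((hfreq D hD0 y₂ hy₂).and_eventually
      (((hcont C y₂ hy₂).eventually_ne hC₂).and
        (((hcont f y₂ hy₂).eventually_const_lt hf₂).and (hΩ.eventually_mem hy₂)))).exists
    exact ⟨y₃, hy₃, hC₃, hD₃, hf₃⟩
  have hgood : ∀ᶠ x in 𝓝 y₀, x ∈ Ω ∧ hermForm α C x ≠ 0 ∧ hermForm α D x ≠ 0 ∧
      0 < hermForm α f x :=
    (hΩ.eventually_mem hy₀).and (((hcont C y₀ hy₀).eventually_ne hy₀C).and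
      (((hcont D y₀ hy₀).eventually_ne hy₀D).and ((hcont f y₀ hy₀).eventually_const_lt hy₀f)))
  have hexp' : ∀ᶠ x in 𝓝 y₀, Real.exp (hermForm α B x / hermForm α C x) =
      hermForm α f x ^ μ * (hermForm α N x / hermForm α D x) :=
    hgood.mono fun x hx => by rw [← hg x hx.1 hx.2.1, hexp x hx.1 hx.2.2.2 hx.2.2.1]
  -- The identity holds near `y₀` and is real analytic, so it continues to the whole ball, also to
  -- points where `f ≤ 0`.
  have hid : ∀ v, ∀ y ∈ Ω, derivIdentity μ α B C D N f v y = 0 := by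
    intro v
    refine AnalyticOnNhd.eqOn_zero_of_preconnected_of_eventuallyEq_zero (𝕜 := ℝ)
      (fun y hy => analyticAt_derivIdentity μ (fun i => hα i y hy) B C D N f v) hΩc hy₀ ?_
    filter_upwards [hgood, hexp'.eventually_nhds] with x hx hx'
    exact derivIdentity_eq_zero (hαd x hx.1) hx.2.1 hx.2.2.1 hx.2.2.2 hx' v
  have hN₀ : hermForm α N y₀ ≠ 0 := by
    intro h
    have h1 := hexp'.self_of_nhds
    rw [h, zero_div, mul_zero] at h1
    exact (Real.exp_pos _).ne' h1
  have hdense := frequently_ne_zero_of_analyticOnNhd hΩc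
    ((((han C).mul (han D)).mul (han N)).mul (han f)) ⟨y₀, hy₀, by
      simp only [ne_eq, mul_eq_zero, Complex.ofReal_eq_zero, not_or]
      exact ⟨⟨⟨hy₀C, hy₀D⟩, hN₀⟩, hy₀f.ne'⟩⟩ hy
  -- On the line through `v` the base point is `s = 1`, which is why `hline` asks for radius `R >
  -- 1`. The sign of `f v` no longer matters.
  have hval : ∀ v ∈ Ω, hermForm α C v ≠ 0 → hermForm α D v ≠ 0 → hermForm α N v ≠ 0 →
      hermForm α f v ≠ 0 → g v = g 0 := by
    intro v hv hCv hDv hNv hfv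
    obtain ⟨R, hR, H, hH, hH₁, hH₂, hHg⟩ := hline v hv
    have h1 : (1 : ℂ) ∈ Metric.ball (0 : ℂ) R := by simpa using hR
    have h0 : (0 : ℂ) ∈ Metric.ball (0 : ℂ) R := by simpa using one_pos.trans hR
    have ha : ∀ i, DifferentiableOn ℂ (fun s : ℂ => α i (s • v)) (Metric.ball 0 R) := fun i s hs =>
      (((hαd _ (hHg s hs).1 i).comp s (by fun_prop :
        DifferentiableAt ℂ (fun s : ℂ => s • v) s))).differentiableWithinAt
    have hp := fun ε => hermPol_line α ε v
    have hne : ∀ ε : ι → ℝ, hermForm α ε v ≠ 0 → hermPol (fun i s => α i (s • v)) (fun i => ε i)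
        (fun i => starRingEnd ℂ (α i ((1 : ℂ) • v))) 1 ≠ 0 := by
      intro ε hε
      rw [hp, one_smul]
      exact Complex.ofReal_ne_zero.2 hε
    have key := eq_of_deriv_identity (μ : ℂ) ha (B := fun i => B i) h1 (hne C hCv) (hne D hDv)
      (hne N hNv) (hne f hfv) (by
        intro s hs
        have hs' := (hHg s hs).1
        have hd := fun ε => deriv_hermPol_line (hαd _ hs') ε
        simp only [logNum, hp, hd]
        exact hid v _ hs') hH hH₁ hH₂ (by
        intro s hs hCs
        rw [hp] at hCs ⊢
        rw [hp, (hHg s hs).2, hg _ (hHg s hs).1 (Complex.ofReal_ne_zero.1 hCs), Complex.ofReal_div,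
          div_mul_cancel₀ _ hCs])
    have h2 := key 1 h1 _ (by simpa using h1 : starRingEnd ℂ 1 ∈ Metric.ball (0 : ℂ) R)
    have h3 := (hHg 0 h0).2
    rw [(hHg 1 h1).2, one_smul] at h2
    rw [map_zero, zero_smul] at h3
    rw [h3] at h2
    exact Complex.ofReal_injective h2
  -- Points covered by `hval` accumulate at `y`, so continuity of `g` at `y` finishes.
  by_contra hne
  obtain ⟨x, hx, hx', hxΩ⟩ := (hdense.and_eventually ((hgy.eventually_ne hne).and
    (hΩ.eventually_mem hy))).exists
  simp only [ne_eq, mul_eq_zero, Complex.ofReal_eq_zero, not_or] at hx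
  exact hx' (hval x hxΩ hx.1.1.1 hx.1.1.2 hx.1.2 hx.2)

end

/-! ### Power series of diastasis type along lines -/

section

variable {n : ℕ}

theorem conj_monomial_smul (j : Fin n → ℕ) (s : ℂ) (v : EuclideanSpace ℂ (Fin n)) :
    ∏ i, starRingEnd ℂ ((s • v) i) ^ j i =
      (∏ i, starRingEnd ℂ (v i) ^ j i) * starRingEnd ℂ s ^ ∑ i, j i := by
  simp only [PiLp.smul_apply, smul_eq_mul, map_mul, mul_pow, Finset.prod_mul_distrib,
    Finset.prod_pow_eq_pow_sum]
  ring

theorem monomial_smul (j : Fin n → ℕ) (s : ℂ) (v : EuclideanSpace ℂ (Fin n)) :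
    ∏ i, (s • v) i ^ j i = (∏ i, v i ^ j i) * s ^ ∑ i, j i := by
  simp only [PiLp.smul_apply, smul_eq_mul, mul_pow, Finset.prod_mul_distrib,
    Finset.prod_pow_eq_pow_sum]
  ring

theorem exists_polarization_line {r : ℝ} {a : (Fin n → ℕ) → (Fin n → ℕ) → ℂ}
    {g : EuclideanSpace ℂ (Fin n) → ℝ} (ha : ∀ j, j ≠ 0 → a j 0 = 0 ∧ a 0 j = 0)
    (hS : ∀ y ∈ Metric.ball (0 : EuclideanSpace ℂ (Fin n)) r,
      HasSum (fun q : (Fin n → ℕ) × (Fin n → ℕ) => a q.1 q.2 * (∏ i, y i ^ q.1 i) *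
        ∏ i, starRingEnd ℂ (y i) ^ q.2 i) (g y : ℂ))
    {v : EuclideanSpace ℂ (Fin n)} (hv : v ∈ Metric.ball 0 r) :
    ∃ R > (1 : ℝ), ∃ H : ℂ → ℂ → ℂ,
      HolAlongCurves (Metric.ball 0 R) H ∧ (∀ s, H s 0 = H 0 0) ∧ (∀ t, H 0 t = H 0 0) ∧
      ∀ s ∈ Metric.ball (0 : ℂ) R, s • v ∈ Metric.ball (0 : EuclideanSpace ℂ (Fin n)) r ∧
        H s (starRingEnd ℂ s) = g (s • v) := by
  rw [mem_ball_zero_iff] at hv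
  have hv1 : 0 < ‖v‖ + 1 := by positivity
  obtain ⟨R, hR, hRv⟩ : ∃ R > (1 : ℝ), R * ‖v‖ < r := by
    -- The denominator `‖v‖ + 1` covers `v = 0` and keeps `R * ‖v‖` strictly below `r`.
    refine ⟨1 + (r - ‖v‖) / (‖v‖ + 1), ?_, ?_⟩
    · have : 0 < (r - ‖v‖) / (‖v‖ + 1) := div_pos (sub_pos.2 hv) hv1
      linarith
    · have h1 : (r - ‖v‖) / (‖v‖ + 1) * ‖v‖ < r - ‖v‖ := by
        rw [div_mul_eq_mul_div, div_lt_iff₀ hv1]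
        nlinarith
      linarith
  have hball : ∀ s ∈ Metric.ball (0 : ℂ) R, s • v ∈ Metric.ball (0 : EuclideanSpace ℂ (Fin n)) r := by
    intro s hs
    rw [mem_ball_zero_iff] at hs ⊢
    rw [norm_smul]
    exact (mul_le_mul_of_nonneg_right hs.le (norm_nonneg v)).trans_lt hRv
  let c : (Fin n → ℕ) × (Fin n → ℕ) → ℂ := fun q =>
    a q.1 q.2 * (∏ i, v i ^ q.1 i) * ∏ i, starRingEnd ℂ (v i) ^ q.2 i
  have hc : ∀ s : ℂ, (fun q : (Fin n → ℕ) × (Fin n → ℕ) => a q.1 q.2 * (∏ i, (s • v) i ^ q.1 i) *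
        ∏ i, starRingEnd ℂ ((s • v) i) ^ q.2 i) =
      fun q => c q * s ^ (∑ i, q.1 i) * starRingEnd ℂ s ^ ∑ i, q.2 i := by
    intro s
    funext q
    rw [monomial_smul, conj_monomial_smul]
    ring
  have hsum0 : ∀ j : Fin n → ℕ, ∑ i, j i = 0 → j = 0 := fun j hj =>
    funext fun i => Finset.sum_eq_zero_iff.1 hj i (Finset.mem_univ i)
  -- Pure terms vanish by the diastasis condition, mixed terms contain the factor that is zero; only
  -- the constant term survives.
  have hval : ∀ s t : ℂ, s = 0 ∨ t = 0 →
      ∑' q, c q * s ^ (∑ i, q.1 i) * t ^ (∑ i, q.2 i) = c 0 := by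
    intro s t hst
    rw [tsum_eq_single 0]
    · simp
    rintro ⟨j, k⟩ hjk
    by_cases hk : k = 0
    · subst hk
      have hj : j ≠ 0 := by rintro rfl; exact hjk rfl
      simp [c, (ha j hj).1]
    by_cases hj : j = 0
    · subst hj
      simp [c, (ha k hk).2]
    rcases hst with rfl | rfl
    · rw [zero_pow fun h => hj (hsum0 j h), mul_zero, zero_mul]
    · rw [zero_pow fun h => hk (hsum0 k h), mul_zero]
  refine ⟨R, hR, fun s t => ∑' q, c q * s ^ (∑ i, q.1 i) * t ^ (∑ i, q.2 i),
    holAlongCurves_tsum fun ρ hρ hρR => ?_, fun s => ?_, fun t => ?_, fun s hs => ⟨hball s hs, ?_⟩⟩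
  -- Convergence at the single point `ρ • v` is absolute, which is the majorant needed for
  -- independent `s` and `t`.
  · have h1 := hS _ (hball ρ (by simpa [abs_of_nonneg hρ] using hρR))
    rw [hc] at h1
    refine h1.summable.norm.congr fun q => ?_
    rw [norm_mul, norm_mul, norm_pow, norm_pow, RCLike.norm_conj, Complex.norm_real,
      Real.norm_of_nonneg hρ]
  · exact (hval s 0 (Or.inr rfl)).trans (hval 0 0 (Or.inr rfl)).symm
  · exact (hval 0 t (Or.inl rfl)).trans (hval 0 0 (Or.inl rfl)).symm
  · have h1 := hS _ (hball s hs)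
    rw [hc] at h1
    exact h1.tsum_eq

/-- Absolute convergence at one point `(ρ, …, ρ)` dominates the series uniformly on the polydisc of
radius `ρ`. -/
theorem eventually_continuousAt_of_hasSum {r : ℝ} (hr : 0 < r)
    {a : (Fin n → ℕ) → (Fin n → ℕ) → ℂ} {g : EuclideanSpace ℂ (Fin n) → ℝ}
    (hS : ∀ y ∈ Metric.ball (0 : EuclideanSpace ℂ (Fin n)) r,
      HasSum (fun q : (Fin n → ℕ) × (Fin n → ℕ) => a q.1 q.2 * (∏ i, y i ^ q.1 i) *
        ∏ i, starRingEnd ℂ (y i) ^ q.2 i) (g y : ℂ)) :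
    ∀ᶠ y in 𝓝 (0 : EuclideanSpace ℂ (Fin n)), ContinuousAt g y := by
  have ht : Tendsto (fun ρ : ℝ => (WithLp.toLp 2 fun _ => (ρ : ℂ) : EuclideanSpace ℂ (Fin n)))
      (𝓝[>] 0) (𝓝 0) := by
    have : Continuous fun ρ : ℝ => (WithLp.toLp 2 fun _ => (ρ : ℂ) : EuclideanSpace ℂ (Fin n)) := by
      fun_prop
    refine (this.tendsto' 0 0 ?_).mono_left nhdsWithin_le_nhds
    ext i
    simp
  obtain ⟨ρ, hρr, hρ⟩ := ((ht.eventually (Metric.ball_mem_nhds 0 hr)).and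
    self_mem_nhdsWithin).exists
  have hρ0 : 0 < ρ := hρ
  let W : Set (EuclideanSpace ℂ (Fin n)) := {y | ∀ i, ‖y i‖ < ρ} ∩ Metric.ball 0 r
  have hW : IsOpen W := by
    refine IsOpen.inter ?_ Metric.isOpen_ball
    simp only [Set.ofPred_forall]
    exact isOpen_iInter_of_finite fun i => isOpen_lt (by fun_prop) continuous_const
  have hW0 : (0 : EuclideanSpace ℂ (Fin n)) ∈ W := ⟨fun i => by simpa using hρ0, by simpa using hr⟩
  have hcont : ContinuousOn (fun y : EuclideanSpace ℂ (Fin n) =>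
      ∑' q : (Fin n → ℕ) × (Fin n → ℕ), a q.1 q.2 * (∏ i, y i ^ q.1 i) *
        ∏ i, starRingEnd ℂ (y i) ^ q.2 i) W := by
    refine continuousOn_tsum (fun q => ?_) (hS _ hρr).summable.norm fun q y hy => ?_
    · have hconj : Continuous (starRingEnd ℂ) := Complex.continuous_conj
      exact Continuous.continuousOn (by fun_prop)
    · simp only [norm_mul, norm_prod, norm_pow, RCLike.norm_conj, Complex.norm_real,
        Real.norm_of_nonneg hρ0.le]
      have h1 : ∀ j : Fin n → ℕ, ∏ i, ‖y i‖ ^ j i ≤ ∏ i, ρ ^ j i := fun j =>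
        Finset.prod_le_prod (fun i _ => by positivity) fun i _ =>
          pow_le_pow_left₀ (norm_nonneg _) (hy.1 i).le _
      have h2 : ∀ j : Fin n → ℕ, 0 ≤ ∏ i, ‖y i‖ ^ j i := fun j => by positivity
      exact mul_le_mul (mul_le_mul_of_nonneg_left (h1 _) (norm_nonneg _)) (h1 _) (h2 _)
        (by positivity)
  filter_upwards [hW.mem_nhds hW0] with y hy
  have h1 : ContinuousOn g W := by
    refine (Complex.continuous_re.comp_continuousOn hcont).congr fun z hz => ?_
    exact (congrArg Complex.re (hS z hz.2).tsum_eq).symm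
  exact h1.continuousAt (hW.mem_nhds hy)

end

/-! ### From germs on the manifold to a common Hermitian form -/

section

variable {n : ℕ} {M : Type*} [TopologicalSpace M] [ChartedSpace (EuclideanSpace ℂ (Fin n)) M] {p : M}

theorem exists_hermForm_of_mem {u : M → ℝ} (hu : (u : Germ (𝓝 p) ℝ) ∈ lambdaTilde n p) :
    ∃ (m : ℕ) (ε : Fin m → ℝ) (α : Fin m → M → ℂ),
      (∀ j, ContMDiffAt 𝓘(ℂ, EuclideanSpace ℂ (Fin n)) 𝓘(ℂ) ω (α j) p) ∧
        ∀ᶠ x in 𝓝 p, u x = hermForm α ε x := by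
  obtain ⟨a, m, ℓ, α, -, -, hα, h⟩ := hu
  -- The constant `a` becomes the weight of the function `1`, so no separate constant term is
  -- carried along.
  refine ⟨m + 1, Fin.cons a fun j : Fin m => if (j : ℕ) < ℓ then (1 : ℝ) else -1,
    Fin.cons (fun _ => 1) α, fun j => ?_, ?_⟩
  · refine Fin.cases ?_ (fun j => ?_) j
    · simpa using contMDiffAt_const
    · simpa using (hα j).1
  · filter_upwards [Germ.coe_eq.1 h] with x hx
    rw [hx, hermSq_eq, hermForm, Fin.sum_univ_succ]
    simp

theorem exists_common_hermForm {κ : Type} [Fintype κ] [DecidableEq κ] {u : κ → M → ℝ}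
    (hu : ∀ k, (u k : Germ (𝓝 p) ℝ) ∈ lambdaTilde n p) :
    ∃ (ι : Type) (_ : Fintype ι) (ε : κ → ι → ℝ) (α : ι → M → ℂ),
      (∀ i, ContMDiffAt 𝓘(ℂ, EuclideanSpace ℂ (Fin n)) 𝓘(ℂ) ω (α i) p) ∧
        ∀ᶠ x in 𝓝 p, ∀ k, u k x = hermForm α (ε k) x := by
  choose m ε α hα h using fun k => exists_hermForm_of_mem (hu k)
  -- All families are joined into one, and each germ puts zero weights outside its own block.
  refine ⟨Σ k, Fin (m k), inferInstance, fun k q => if q.1 = k then ε q.1 q.2 else 0,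
    fun q => α q.1 q.2, fun q => hα q.1 q.2, ?_⟩
  filter_upwards [eventually_all.2 h] with x hx k
  rw [hx k, hermForm, hermForm, Fintype.sum_sigma, Finset.sum_eq_single k]
  · simp
  · intro k' _ hk'
    simp [hk']
  · simp

theorem analyticAt_comp_symm [IsManifold 𝓘(ℂ, EuclideanSpace ℂ (Fin n)) ω M] {α : M → ℂ}
    (hα : ContMDiffAt 𝓘(ℂ, EuclideanSpace ℂ (Fin n)) 𝓘(ℂ) ω α p)
    {φ : OpenPartialHomeomorph M (EuclideanSpace ℂ (Fin n))}
    (hφ : φ ∈ IsManifold.maximalAtlas 𝓘(ℂ, EuclideanSpace ℂ (Fin n)) ω M) (hp : p ∈ φ.source) :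
    AnalyticAt ℂ (fun y => α (φ.symm y)) (φ p) := by
  have h1 := contMDiffAt_symm_of_mem_maximalAtlas hφ (φ.map_source hp)
  have h2 : ContMDiffAt 𝓘(ℂ, EuclideanSpace ℂ (Fin n)) 𝓘(ℂ) ω α (φ.symm (φ p)) := by
    rwa [φ.left_inv hp]
  exact (contMDiffAt_iff_contDiffAt.1 (h2.comp (φ p) h1)).analyticAt

end

end Umehara

/-! ### Conclusion in a centered chart -/

theorem theorem2p1 {n : ℕ} {M : Type*} [TopologicalSpace M]
    [ChartedSpace (EuclideanSpace ℂ (Fin n)) M]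
    [IsManifold 𝓘(ℂ, EuclideanSpace ℂ (Fin n)) ω M] (p : M) (μ : ℝ)
    (k : Umehara.KTilde n p) (g : M → ℝ) (hg : Umehara.IsGivenBy g k)
    (hd : Umehara.IsDiastasisType n p g) :
    ((fun x => Real.exp (g x) : M → ℝ) : Germ (𝓝 p) ℝ) ∉
      Umehara.powMul n p μ \ Umehara.constGerms p := by
  rintro ⟨⟨f, W, h, N, D, hf, ⟨hN, hD, hD0, -⟩, hW, hfpos, hWf⟩, hnc⟩
  obtain ⟨B, C, ⟨hB, hC, hC0, -⟩, hgBC⟩ := hg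
  obtain ⟨φ, hφ, hp, hφp, a, ha, hsum⟩ := hd
  obtain ⟨ι, _, ε, α, hα, hu⟩ := Umehara.exists_common_hermForm (n := n) (p := p)
    (u := ![B, C, D, N, f]) (by
      intro i
      fin_cases i
      exacts [hB, hC, hD, hN, hf])
  have ht0 : (0 : EuclideanSpace ℂ (Fin n)) ∈ φ.target := hφp ▸ φ.map_source hp
  have hsymm : φ.symm 0 = p := by rw [← hφp, φ.left_inv hp]
  have htend : Tendsto φ.symm (𝓝 0) (𝓝 p) := by
    have := φ.continuousAt_symm ht0
    rwa [ContinuousAt, hsymm] at this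
  have htend' : Tendsto φ (𝓝 p) (𝓝 0) := by
    have := φ.continuousAt hp
    rwa [ContinuousAt, hφp] at this
  have hαan : ∀ᶠ y in 𝓝 (0 : EuclideanSpace ℂ (Fin n)), ∀ i,
      AnalyticAt ℂ (fun y => α i (φ.symm y)) y := by
    refine eventually_all.2 fun i => ?_
    have := Umehara.analyticAt_comp_symm (hα i) hφ hp
    rw [hφp] at this
    exact this.eventually_analyticAt
  obtain ⟨r, hr, hball⟩ := Metric.eventually_nhds_iff_ball.1
    (hαan.and ((φ.open_target.eventually_mem ht0).and ((htend.eventually hu).and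
      ((htend.eventually hgBC).and ((htend.eventually hWf).and
        ((htend.eventually (Germ.coe_eq.1 hW)).and (htend.eventually hsum)))))))
  set α' : ι → EuclideanSpace ℂ (Fin n) → ℂ := fun i y => α i (φ.symm y)
  have huy : ∀ y ∈ Metric.ball (0 : EuclideanSpace ℂ (Fin n)) r, ∀ k,
      (![B, C, D, N, f] : Fin 5 → M → ℝ) k (φ.symm y) = Umehara.hermForm α' (ε k) y :=
    fun y hy => (hball y hy).2.2.1
  have hS : ∀ y ∈ Metric.ball (0 : EuclideanSpace ℂ (Fin n)) r,
      HasSum (fun q : (Fin n → ℕ) × (Fin n → ℕ) => a q.1 q.2 * (∏ i, y i ^ q.1 i) *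
        ∏ i, starRingEnd ℂ (y i) ^ q.2 i) (g (φ.symm y) : ℂ) := by
    intro y hy
    have := (hball y hy).2.2.2.2.2.2
    rwa [φ.right_inv (hball y hy).2.1] at this
  have hin : ∀ᶠ x in 𝓝 p, φ x ∈ Metric.ball (0 : EuclideanSpace ℂ (Fin n)) r ∧
      φ.symm (φ x) = x := by
    filter_upwards [htend' (Metric.ball_mem_nhds 0 hr), φ.open_source.mem_nhds hp] with x h1 h2
    exact ⟨h1, φ.left_inv h2⟩
  have hnz : ∀ k, (((![B, C, D, N, f] : Fin 5 → M → ℝ) k : M → ℝ) : Germ (𝓝 p) ℝ) ≠ 0 →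
      ∃ y ∈ Metric.ball (0 : EuclideanSpace ℂ (Fin n)) r, Umehara.hermForm α' (ε k) y ≠ 0 := by
    intro k hk
    by_contra! hz
    refine hk (Germ.coe_eq.2 ?_)
    filter_upwards [hin] with x hx
    have h1 := huy _ hx.1 k
    rw [hx.2, hz _ hx.1] at h1
    exact h1
  have hfp : ∃ y ∈ Metric.ball (0 : EuclideanSpace ℂ (Fin n)) r, 0 < Umehara.hermForm α' (ε 4) y := by
    obtain ⟨x, hx, hxin⟩ := (hfpos.and_eventually hin).exists
    refine ⟨φ x, hxin.1, ?_⟩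
    rw [← huy _ hxin.1 4, hxin.2]
    exact hx
  -- The chart is the one from the diastasis condition, so the series of `g` has no pure terms in
  -- exactly these coordinates.
  have hconst : ∀ᶠ y in 𝓝 (0 : EuclideanSpace ℂ (Fin n)), g (φ.symm y) = g (φ.symm 0) := by
    filter_upwards [Umehara.eventually_continuousAt_of_hasSum (g := fun y => g (φ.symm y)) hr hS,
      Metric.ball_mem_nhds 0 hr] with y hy hyr
    refine Umehara.eq_of_exp_eq (g := fun y => g (φ.symm y)) (μ := μ) (α := α') (B := ε 0)
      (C := ε 1) (D := ε 2) (N := ε 3) (f := ε 4) (fun i y hy => (hball y hy).1 i) ?_ ?_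
      (hnz 1 hC0) (hnz 2 hD0) hfp (fun v hv => Umehara.exists_polarization_line ha hS hv) hyr hy
    · intro y hy hne
      rw [← huy y hy 1] at hne
      rw [← huy y hy 0, ← huy y hy 1]
      exact (hball y hy).2.2.2.1 hne
    · intro y hy hpos hne
      rw [← huy y hy 2] at hne
      rw [← huy y hy 4] at hpos
      rw [← huy y hy 2, ← huy y hy 3, ← huy y hy 4]
      exact ((hball y hy).2.2.2.2.2.1).trans ((hball y hy).2.2.2.2.1 hpos hne)
  refine hnc ⟨Real.exp (g p), Germ.coe_eq.2 ?_⟩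
  filter_upwards [htend'.eventually hconst, hin] with x hx hxin
  rw [hxin.2, hsymm] at hx
  rw [hx]
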